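/- **Setting.** Let $\mathcal A$ be a unital algebra over $\mathbb C$ and let $\varphi,\varphi':\mathcal A\to\mathbb C$ be linear with $\varphi(1_{\mathcal A})=1$ and $\varphi'(1_{\mathcal A})=0$ (an infinitesimal non-commutative probability space). Put $\varphi_n(a_1,\dots,a_n)=\varphi(a_1\cdots a_n)$ and $\varphi'_n(a_1,\dots,a_n)=\varphi'(a_1\cdots a_n)$, the products being taken in $\mathcal A$. **Monotone cumulants.** For a non-crossing partition $\pi$ of $[n]$ let $\tau(\pi)!=\prod_{V\in\pi}N(V)$, where $N(V)$ is the number of blocks $W\in\pi$ with $W\subseteq\{\min V,\dots,\max V\}$. Let $\mathcal{NC}(n)$ be the set of non-crossing partitions of $[n]$, and let $\mathcal M(n)$ be the set of monotone partitions $(\pi,\lambda)$: $\pi\in\mathcal{NC}(n)$ and $\lambda:\pi\to\{1,\dots,|\pi|\}$ is a bijection with $\lambda(W)<\lambda(V)$ whenever $V\ne W$ and $V$ is nested inside $W$ (i.e. there are $i,j\in W$ with $i<v<j$ for all $v\in V$). For families $(f_m)_{m\ge1}$, $(f'_m)_{m\ge1}$ of functionals $\mathcal A^m\to\mathbb C$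 put $$f_\pi(a_1,\dots,a_n)=\prod_{V\in\pi}f_{|V|}(a_V),\qquad \partial f_\pi(a_1,\dots,a_n)=\sum_{V\in\pi}f'_{|V|}(a_V)\prod_{W\in\pi,\,W\neq V}f_{|W|}(a_W),$$ where $a_V=(a_{v_1},\dots,a_{v_k})$ for $V=\{v_1<\dots<v_k\}$. The monotone cumulants $h_n$ and the infinitesimal monotone cumulants $h'_n$ are defined recursively by $$\varphi_n(a_1,\dots,a_n)=\sum_{\pi\in\mathcal{NC}(n)}\frac1{\tau(\pi)!}h_\pi(a_1,\dots,a_n),\qquad \varphi'_n(a_1,\dots,a_n)=\sum_{(\pi,\lambda)\in\mathcal M(n)}\frac1{|\pi|!}\,\partial h_\pi(a_1,\dots,a_n)\qquad(n\ge1).$$ **Hopf algebra.** Let $T_+(\mathcal A)=\bigoplus_{n>0}\mathcal A^{\otimes n}$, whose pure tensors are written as words $a_1\cdots a_n$, and let $H=T(T_+(\mathcal A))$ with unit $\mathbf 1$, product written $w_1|w_2$, and coproduct $\Delta:H\to H\otimes H$ the algebra morphism with $$\Delta(a_1\cdots a_n)=\sum_{S\subseteq[n]}a_S\otimes a_{J_1}|\cdots|a_{J_k},$$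 where $a_S$ is the subword of letters with positions in $S$ (with $a_\emptyset=\mathbf 1$) and $J_1,\dots,J_k$ are the interval components of $[n]\setminus S$ from left to right. Let $H_+=T_+(T_+(\mathcal A))$ be the kernel of the counit $\varepsilon$. Let $\mathbb G=\{z+\hbar w: z,w\in\mathbb C\}$ with $\hbar^2=0$. For $\mathbb C$-linear $f,g:H\to\mathbb G$ put $f\star g=m_{\mathbb G}(f\otimes g)\Delta$, and $\exp^\star(f)=\sum_{k\ge0}f^{\star k}/k!$ with $f^{\star0}=\varepsilon$; for the $f$ considered below this sum is finite at each element of $H$. A linear $f:H\to\mathbb G$ is an infinitesimal character if $f(\mathbf 1)=0$ and $f(w_1|w_2)=0$ for all $w_1,w_2\in H_+$. Let $\Phi:H\to\mathbb C$ be the unital multiplicative linear map with $\Phi(a_1\cdots a_n)=\varphi_n(a_1,\dots,a_n)$ on words, and let $\Phi':H\to\mathbb C$ be the linear map with $\Phi'(a_1\cdots a_n)=\varphi'_n(a_1,\dots,a_n)$ on words and $\Phi'(w_1|w_2)=\Phi(w_1)\Phi'(w_2)+\Phi'(w_1)\Phi(w_2)$ for all $w_1,w_2\in H$. Equivalently,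 $\tilde\Phi=\Phi+\hbar\Phi'$ is the $\mathbb G$-valued character of $H$ extending $\tilde\varphi=\varphi+\hbar\varphi'$. **Proposition.** Let $\rho,\rho':H\to\mathbb C$ be linear maps such that $\tilde\rho=\rho+\hbar\rho'$ is an infinitesimal character and $\tilde\Phi=\exp^\star(\tilde\rho)$. Then for all $n\ge1$ and all $a_1,\dots,a_n\in\mathcal A$, the value of $\rho'$ on the word $w=a_1\cdots a_n$ is the infinitesimal monotone cumulant: $$\rho'(a_1\cdots a_n)=h'_n(a_1,\dots,a_n).$$ -/

import Mathlib

open scoped TensorProduct BigOperators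

noncomputable section

namespace InfMonotone

/-! ### Set partitions, cumulants -/

section Partitions

variable {n : ℕ}

/-- Set partitions of `[n]`, modelled on `Fin n`; the blocks of `π` are the members of `π.parts`. -/
abbrev SetPartition (n : ℕ) : Type := Finpartition (Finset.univ : Finset (Fin n))

/-- `π` is non-crossing. -/
def IsNonCrossing (π : SetPartition n) : Prop :=
  ∀ V ∈ π.parts, ∀ W ∈ π.parts, ∀ i j k l : Fin n, i < j → j < k → k < l →
    i ∈ V → k ∈ V → j ∈ W → l ∈ W → V = W

open Classical in
/-- `NC(n)`, the set of non-crossing partitions of `[n]`. -/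
def NC (n : ℕ) : Finset (SetPartition n) := Finset.univ.filter IsNonCrossing

/-- The block `V` is nested inside the block `W`. -/
def IsNested (V W : Finset (Fin n)) : Prop :=
  V ≠ W ∧ ∃ i ∈ W, ∃ j ∈ W, ∀ v ∈ V, i < v ∧ v < j

/-- An ordering `lam` of the blocks of `π` (a bijection onto a chain with `|π|` elements) is monotone
if a block nested inside another one always gets the larger label. -/
def IsMonotoneLabelling (π : SetPartition n) (lam : π.parts ≃ Fin π.parts.card) : Prop :=
  ∀ V W : π.parts, IsNested V.1 W.1 → lam W < lam V

open Classical in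
/-- `M(n)`, the set of monotone partitions `(π, lam)` of `[n]`. -/
def MonotonePartitions (n : ℕ) :
    Finset ((π : SetPartition n) × (π.parts ≃ Fin π.parts.card)) :=
  (NC n).sigma fun π => Finset.univ.filter (IsMonotoneLabelling π)

open Classical in
/-- `N(V)`, the number of blocks `W ∈ π` with `W ⊆ {min V, min V + 1, …, max V}`. -/
def nestingNumber (π : SetPartition n) (V : Finset (Fin n)) : ℕ :=
  (π.parts.filter fun W => ∀ w ∈ W, ∃ i ∈ V, ∃ j ∈ V, i ≤ w ∧ w ≤ j).card

/-- The tree factorial `τ(π)! = ∏_{V ∈ π} N(V)` of the nesting forest of `π`. -/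
def treeFactorial (π : SetPartition n) : ℕ := ∏ V ∈ π.parts, nestingNumber π V

variable {A : Type*}

/-- The tuple `a_V = (a_{v₁}, …, a_{v_k})` for a block `V = {v₁ < ⋯ < v_k}`. -/
def restrict (a : Fin n → A) (V : Finset (Fin n)) : Fin V.card → A :=
  fun i => a (V.orderEmbOfFin rfl i)

/-- `f_π(a₁, …, a_n) = ∏_{V ∈ π} f_{|V|}(a_V)`. -/
def blockProd (f : (m : ℕ) → (Fin m → A) → ℂ) (π : SetPartition n) (a : Fin n → A) : ℂ :=
  ∏ V ∈ π.parts, f V.card (restrict a V)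

/-- `∂f_π(a₁, …, a_n) = ∑_{V ∈ π} f'_{|V|}(a_V) ∏_{W ∈ π, W ≠ V} f_{|W|}(a_W)`. -/
def blockDeriv (f f' : (m : ℕ) → (Fin m → A) → ℂ) (π : SetPartition n) (a : Fin n → A) : ℂ :=
  ∑ V ∈ π.parts, f' V.card (restrict a V) * ∏ W ∈ π.parts.erase V, f W.card (restrict a W)

/-- The family `f` cut off to arities below `n`. -/
def truncate (n : ℕ) (f : (m : ℕ) → m < n → (Fin m → A) → ℂ) (m : ℕ) (b : Fin m → A) : ℂ :=
  if h : m < n then f m h b else 0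

/-- Every block of a partition other than the one-block partition has fewer than `n` elements. -/
theorem card_lt_of_mem {π : SetPartition n} (hπ : π.parts ≠ {Finset.univ})
    {V : Finset (Fin n)} (hV : V ∈ π.parts) : V.card < n := by
  have hle : V.card ≤ n := by simpa using Finset.card_le_univ V
  refine lt_of_le_of_ne hle fun h => hπ ?_
  have hu : V = Finset.univ := by
    rw [← Finset.card_eq_iff_eq_univ]; simpa using h
  subst hu
  refine Finset.eq_singleton_iff_unique_mem.2 ⟨hV, fun W hW => ?_⟩
  by_contra hne
  have hd : Disjoint W Finset.univ := π.disjoint hW hV hne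
  exact π.ne_bot hW (by simpa using hd.eq_bot_of_le (Finset.subset_univ W))

/-- The blocks of the one-block partition of `[n]`. -/
theorem exists_unique_one (hn : 1 ≤ n) :
    ∃ π ∈ NC n, π.parts = {Finset.univ} ∧
      ∀ σ : SetPartition n, σ.parts = {Finset.univ} → σ = π := by
  have : (Finset.univ : Finset (Fin n)) ≠ ⊥ := by
    have : NeZero n := ⟨by omega⟩
    exact Finset.univ_nonempty.ne_empty
  refine ⟨Finpartition.indiscrete this, ?_, rfl, fun σ hσ => Finpartition.ext hσ⟩
  simp only [NC, Finset.mem_filter, Finset.mem_univ, true_and]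
  intro V hV W hW _ _ _ _ _ _ _ _ _ _ _
  simp only [Finpartition.indiscrete_parts, Finset.mem_singleton] at hV hW
  rw [hV, hW]

theorem family_card_eq {n : ℕ} (f : (m : ℕ) → (Fin m → A) → ℂ) (a : Fin n → A) (k : ℕ) (hk : k = n)
    (g : Fin k ↪o Fin n) : f k (fun i => a (g i)) = f n a := by
  subst hk
  have hs : Function.Surjective g := Finite.surjective_of_injective g.injective
  have : (g : Fin k → Fin k) = id :=
    (StrictMono.range_inj g.strictMono strictMono_id).1 (by rw [hs.range_eq, Set.range_id])
  congr 1
  funext i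
  rw [this]; rfl

end Partitions

section Cumulants

variable {A : Type*} [Ring A] [Algebra ℂ A]

/-- The multivariate moments `φ_n(a₁, …, a_n) = φ(a₁ ⋯ a_n)`. -/
def moment (φ : A →ₗ[ℂ] ℂ) (n : ℕ) (a : Fin n → A) : ℂ := φ (List.ofFn a).prod

open Classical in
/-- The monotone cumulants `h_n`, defined recursively by solving
`φ_n(a₁, …, a_n) = ∑_{π ∈ NC(n)} (1 / τ(π)!) h_π(a₁, …, a_n)` for `h_n`, which occurs on the right
only in the term of the one-block partition (see `moment_eq_sum_monotoneCumulant`). -/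
def monotoneCumulant (φ : A →ₗ[ℂ] ℂ) (n : ℕ) (a : Fin n → A) : ℂ :=
  moment φ n a - ∑ π ∈ (NC n).filter (fun π => π.parts ≠ {Finset.univ}),
    (1 / (treeFactorial π : ℂ)) *
      blockProd (truncate n fun m _ b => monotoneCumulant φ m b) π a
termination_by n

open Classical in
/-- The infinitesimal monotone cumulants `h'_n`, defined recursively by solving
`φ'_n(a₁, …, a_n) = ∑_{(π, lam) ∈ M(n)} (1 / |π|!) ∂h_π(a₁, …, a_n)` for `h'_n`, which occurs on the
right only in the term of the one-block partition (see `moment_eq_sum_infMonotoneCumulant`). -/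
def infMonotoneCumulant (φ φ' : A →ₗ[ℂ] ℂ) (n : ℕ) (a : Fin n → A) : ℂ :=
  moment φ' n a - ∑ p ∈ (MonotonePartitions n).filter (fun p => p.1.parts ≠ {Finset.univ}),
    (1 / (p.1.parts.card.factorial : ℂ)) *
      blockDeriv (monotoneCumulant φ) (truncate n fun m _ b => infMonotoneCumulant φ φ' m b) p.1 a
termination_by n

/-- The defining relation of the monotone cumulants. -/
theorem moment_eq_sum_monotoneCumulant (φ : A →ₗ[ℂ] ℂ) (n : ℕ) (hn : 1 ≤ n) (a : Fin n → A) :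
    moment φ n a = ∑ π ∈ NC n, (1 / (treeFactorial π : ℂ)) *
      blockProd (monotoneCumulant φ) π a := by
  classical
  obtain ⟨o, ho, hop, huniq⟩ := exists_unique_one hn
  rw [← Finset.sum_filter_not_add_sum_filter _ (fun π : SetPartition n => π.parts = {Finset.univ})]
  have h1 : (NC n).filter (fun π : SetPartition n => π.parts = {Finset.univ}) = {o} := by
    ext σ
    simp only [Finset.mem_filter, Finset.mem_singleton]
    exact ⟨fun h => huniq σ h.2, fun h => h ▸ ⟨ho, hop⟩⟩
  have h2 : treeFactorial o = 1 := by
    have : NeZero n := ⟨by omega⟩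
    have : ∀ w : Fin n, ∃ i : Fin n, i ≤ w ∧ ∃ x, w ≤ x := fun w => ⟨w, le_rfl, w, le_rfl⟩
    simp [treeFactorial, nestingNumber, hop, Finset.filter_singleton, this]
  have h3 : blockProd (monotoneCumulant φ) o a = monotoneCumulant φ n a := by
    simp only [blockProd, hop, Finset.prod_singleton]
    exact family_card_eq (monotoneCumulant φ) a _ (by simp) _
  rw [h1, Finset.sum_singleton, h2, h3, monotoneCumulant]
  have : ∀ π ∈ (NC n).filter (fun π => π.parts ≠ {Finset.univ}),
      (1 / (treeFactorial π : ℂ)) *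
        blockProd (truncate n fun m _ b => monotoneCumulant φ m b) π a =
      (1 / (treeFactorial π : ℂ)) * blockProd (monotoneCumulant φ) π a := by
    intro π hπ
    congr 1
    refine Finset.prod_congr rfl fun V hV => ?_
    rw [truncate, dif_pos (card_lt_of_mem (Finset.mem_filter.1 hπ).2 hV)]
  rw [Finset.sum_congr rfl this]
  simp

/-- The defining relation of the infinitesimal monotone cumulants. -/
theorem moment_eq_sum_infMonotoneCumulant (φ φ' : A →ₗ[ℂ] ℂ) (n : ℕ) (hn : 1 ≤ n) (a : Fin n → A) :
    moment φ' n a = ∑ p ∈ MonotonePartitions n, (1 / (p.1.parts.card.factorial : ℂ)) *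
      blockDeriv (monotoneCumulant φ) (infMonotoneCumulant φ φ') p.1 a := by
  classical
  obtain ⟨o, ho, hop, huniq⟩ := exists_unique_one hn
  have hcard : o.parts.card = 1 := by rw [hop]; simp
  have hsub : Subsingleton (o.parts) := by
    rw [← Finset.card_le_one_iff_subsingleton_coe]; omega
  let e : o.parts ≃ Fin o.parts.card := o.parts.equivFin
  have hM : (MonotonePartitions n).filter (fun p => p.1.parts = {Finset.univ}) = {⟨o, e⟩} := by
    ext ⟨σ, lam⟩
    simp only [MonotonePartitions, Finset.mem_filter, Finset.mem_sigma, Finset.mem_singleton,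
      Finset.mem_univ, true_and]
    constructor
    · rintro ⟨-, h⟩
      obtain rfl := huniq σ h
      congr 1
      ext x
      have : Subsingleton (Fin σ.parts.card) := lam.symm.subsingleton
      exact congrArg Fin.val (Subsingleton.elim _ _)
    · intro h
      obtain rfl : σ = o := congrArg Sigma.fst h
      exact ⟨⟨ho, fun V W hVW => absurd (congrArg Subtype.val (Subsingleton.elim V W)) hVW.1⟩, hop⟩
  rw [← Finset.sum_filter_not_add_sum_filter _
    (fun p : (π : SetPartition n) × (π.parts ≃ Fin π.parts.card) => p.1.parts = {Finset.univ}),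
    hM, Finset.sum_singleton]
  have h3 : blockDeriv (monotoneCumulant φ) (infMonotoneCumulant φ φ') o a =
      infMonotoneCumulant φ φ' n a := by
    simp only [blockDeriv, hop, Finset.sum_singleton, Finset.erase_singleton, Finset.prod_empty,
      mul_one]
    exact family_card_eq (infMonotoneCumulant φ φ') a _ (by simp) _
  dsimp only
  rw [h3, hcard, infMonotoneCumulant]
  have : ∀ p ∈ (MonotonePartitions n).filter (fun p => p.1.parts ≠ {Finset.univ}),
      (1 / (p.1.parts.card.factorial : ℂ)) * blockDeriv (monotoneCumulant φ)
        (truncate n fun m _ b => infMonotoneCumulant φ φ' m b) p.1 a =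
      (1 / (p.1.parts.card.factorial : ℂ)) * blockDeriv (monotoneCumulant φ)
        (infMonotoneCumulant φ φ') p.1 a := by
    intro p hp
    congr 1
    refine Finset.sum_congr rfl fun V hV => ?_
    rw [truncate, dif_pos (card_lt_of_mem (Finset.mem_filter.1 hp).2 hV)]
  rw [Finset.sum_congr rfl this]
  simp

end Cumulants

/-! ### The double tensor algebra -/

section Hopf

variable (A : Type*) [Ring A] [Algebra ℂ A]

/-- `T₊(A) = ⨁_{n > 0} A^{⊗ n}`; the summand with index `n` is `A^{⊗ (n + 1)}`. -/
abbrev TPlus : Type _ := DirectSum ℕ fun n => ⨂[ℂ]^(n + 1) A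

/-- The double tensor algebra `H = T(T₊(A))`; its multiplication is the bar product. -/
abbrev H : Type _ := TensorAlgebra ℂ (TPlus A)

variable {A}

/-- The word `a₁ ⋯ a_k ∈ T₊(A) ⊆ H`, where the empty word is the unit `𝟏` of `H`. -/
def word : List A → H A
  | [] => 1
  | x :: l => TensorAlgebra.ι ℂ (DirectSum.lof ℂ ℕ (fun n => ⨂[ℂ]^(n + 1) A) l.length
      (PiTensorProduct.tprod ℂ fun i : Fin (l.length + 1) => (x :: l).get i))

theorem word_cons_eq (x : A) (l : List A) (m : ℕ) (b : Fin (m + 1) → A)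
    (h : x :: l = List.ofFn b) :
    word (x :: l) = TensorAlgebra.ι ℂ (DirectSum.lof ℂ ℕ (fun n => ⨂[ℂ]^(n + 1) A) m
      (PiTensorProduct.tprod ℂ b)) := by
  obtain rfl : l.length = m := by simpa using congrArg List.length h
  have : b = fun i : Fin (l.length + 1) => (x :: l).get i := by
    funext i
    simp only [h, List.get_eq_getElem, List.getElem_ofFn]
  rw [this, word]

theorem word_ofFn (m : ℕ) (b : Fin (m + 1) → A) :
    word (List.ofFn b) = TensorAlgebra.ι ℂ (DirectSum.lof ℂ ℕ (fun n => ⨂[ℂ]^(n + 1) A) m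
      (PiTensorProduct.tprod ℂ b)) := by
  rw [List.ofFn_succ]
  exact word_cons_eq _ _ _ _ (List.ofFn_succ).symm

/-- The bar product of the words `a_{J₁} | ⋯ | a_{J_k}`. -/
def barWord {n : ℕ} (a : Fin n → A) (L : List (List (Fin n))) : H A :=
  (L.map fun J => word (J.map a)).prod

/-- The elements of `S ⊆ [n]` in increasing order. -/
def subsetList {n : ℕ} (S : Finset (Fin n)) : List (Fin n) :=
  (List.finRange n).filter fun i => decide (i ∈ S)

/-- The interval components `J₁, …, J_k` of `[n] ∖ S` from left to right: `1, …, n` is cut at the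
elements of `S`. The pieces between neighbouring cuts may be empty; empty pieces
contribute the factor `𝟏` to a bar product. -/
def gaps {n : ℕ} (S : Finset (Fin n)) : List (List (Fin n)) :=
  (List.finRange n).splitOnP fun i => decide (i ∈ S)

/-- The summand `a_S ⊗ a_{J₁} | ⋯ | a_{J_k}` of the coproduct. -/
def coprodTerm {n : ℕ} (S : Finset (Fin n)) (a : Fin n → A) : H A ⊗[ℂ] H A :=
  word ((subsetList S).map a) ⊗ₜ[ℂ] barWord a (gaps S)

theorem word_update_of_notMem {n : ℕ} (a : Fin n → A) (l : List (Fin n)) (i : Fin n) (hi : i ∉ l)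
    (x : A) : word (l.map (Function.update a i x)) = word (l.map a) := by
  congr 1
  refine List.map_congr_left fun j hj => ?_
  rw [Function.update_of_ne]
  rintro rfl
  exact hi hj

theorem exists_linear_word {n : ℕ} (a : Fin n → A) (l : List (Fin n)) (hl : l.Nodup) (i : Fin n)
    (hi : i ∈ l) : ∃ T : A →ₗ[ℂ] H A, ∀ x, word (l.map (Function.update a i x)) = T x := by
  cases l with
  | nil => simp at hi
  | cons j l =>
    set g : Fin (l.length + 1) → Fin n := fun k => (j :: l).get k with hg
    have hginj : Function.Injective g := List.nodup_iff_injective_get.1 hl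
    obtain ⟨k, hk⟩ := List.mem_iff_get.1 hi
    refine ⟨TensorAlgebra.ι ℂ ∘ₗ DirectSum.lof ℂ ℕ (fun n => ⨂[ℂ]^(n + 1) A) l.length ∘ₗ
      (PiTensorProduct.tprod ℂ).toLinearMap (a ∘ g) k, fun x => ?_⟩
    have h1 : (j :: l).map (Function.update a i x) =
        List.ofFn (Function.update (a ∘ g) k x) := by
      have : (j :: l) = List.ofFn g := by rw [hg]; exact (List.ofFn_get _).symm
      conv_lhs => rw [this]
      rw [List.map_ofFn]
      congr 1
      rw [← hk]
      exact Function.update_comp_eq_of_injective a hginj k x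
    rw [h1, word_ofFn]
    rfl

theorem exists_linear_barWord {n : ℕ} (a : Fin n → A) (L : List (List (Fin n)))
    (hL : L.flatten.Nodup) (i : Fin n) :
    (i ∉ L.flatten → ∀ x, barWord (Function.update a i x) L = barWord a L) ∧
    (i ∈ L.flatten → ∃ T : A →ₗ[ℂ] H A, ∀ x, barWord (Function.update a i x) L = T x) := by
  induction L with
  | nil => simp [barWord]
  | cons J L ih =>
    rw [List.flatten_cons, List.nodup_append] at hL
    obtain ⟨hJ, hL', hd⟩ := hL
    obtain ⟨ih1, ih2⟩ := ih hL'
    have hc : ∀ b : Fin n → A, barWord b (J :: L) = word (J.map b) * barWord b L := fun b => by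
      simp [barWord]
    refine ⟨fun hi x => ?_, fun hi => ?_⟩
    · rw [List.flatten_cons, List.mem_append, not_or] at hi
      rw [hc, hc, word_update_of_notMem _ _ _ hi.1, ih1 hi.2]
    · rw [List.flatten_cons, List.mem_append] at hi
      by_cases hiJ : i ∈ J
      · have hiL : i ∉ L.flatten := fun h => hd i hiJ i h rfl
        obtain ⟨T, hT⟩ := exists_linear_word a J hJ i hiJ
        refine ⟨LinearMap.mulRight ℂ (barWord a L) ∘ₗ T, fun x => ?_⟩
        rw [hc, hT, ih1 hiL]
        rfl
      · obtain ⟨T, hT⟩ := ih2 (hi.resolve_left hiJ)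
        refine ⟨LinearMap.mulLeft ℂ (word (J.map a)) ∘ₗ T, fun x => ?_⟩
        rw [hc, hT, word_update_of_notMem _ _ _ hiJ]
        rfl

theorem flatten_splitOnP {α : Type*} (p : α → Bool) (l : List α) :
    (l.splitOnP p).flatten = l.filter fun x => !p x := by
  induction l with
  | nil => simp
  | cons x l ih =>
    rw [List.splitOnP_cons_eq_if_modifyHead]
    cases hx : p x
    · have hne := List.splitOnP_ne_nil (p := p) l
      cases hs : l.splitOnP p with
      | nil => exact absurd hs hne
      | cons y ys => simp [hx, ← ih, hs]
    · simp [hx, ih]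

theorem exists_linear_coprodTerm {n : ℕ} (S : Finset (Fin n)) (a : Fin n → A) (i : Fin n) :
    ∃ T : A →ₗ[ℂ] H A ⊗[ℂ] H A, ∀ x, coprodTerm S (Function.update a i x) = T x := by
  have hfl : (gaps S).flatten = (List.finRange n).filter fun j => !decide (j ∈ S) :=
    flatten_splitOnP _ _
  have hnd : (gaps S).flatten.Nodup := by
    rw [hfl]; exact (List.nodup_finRange n).filter _
  have hsub : (subsetList S).Nodup := (List.nodup_finRange n).filter _
  obtain ⟨h1, h2⟩ := exists_linear_barWord a (gaps S) hnd i
  by_cases hi : i ∈ S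
  · have hi1 : i ∈ subsetList S := by simp [subsetList, hi]
    have hi2 : i ∉ (gaps S).flatten := by rw [hfl]; simp [hi]
    obtain ⟨T, hT⟩ := exists_linear_word a _ hsub i hi1
    refine ⟨(TensorProduct.mk ℂ (H A) (H A)).flip (barWord a (gaps S)) ∘ₗ T, fun x => ?_⟩
    rw [coprodTerm, hT, h1 hi2]
    rfl
  · have hi1 : i ∉ subsetList S := by simp [subsetList, hi]
    have hi2 : i ∈ (gaps S).flatten := by rw [hfl]; simp [hi]
    obtain ⟨T, hT⟩ := h2 hi2
    refine ⟨TensorProduct.mk ℂ (H A) (H A) (word ((subsetList S).map a)) ∘ₗ T, fun x => ?_⟩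
    rw [coprodTerm, hT, word_update_of_notMem _ _ _ hi1]
    rfl

/-- `coprodTerm S` as a multilinear map. -/
def coprodTermMultilinear {n : ℕ} (S : Finset (Fin n)) :
    MultilinearMap ℂ (fun _ : Fin n => A) (H A ⊗[ℂ] H A) where
  toFun := coprodTerm S
  map_update_add' := by
    intro hdec a i x y
    obtain rfl : hdec = instDecidableEqFin n := Subsingleton.elim _ _
    obtain ⟨T, hT⟩ := exists_linear_coprodTerm S a i
    rw [hT, hT, hT, map_add]
  map_update_smul' := by
    intro hdec a i c x
    obtain rfl : hdec = instDecidableEqFin n := Subsingleton.elim _ _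
    obtain ⟨T, hT⟩ := exists_linear_coprodTerm S a i
    rw [hT, hT, map_smul]

/-- The coproduct `Δ : H → H ⊗ H`, the multiplicative extension of
`Δ(a₁ ⋯ a_n) = ∑_{S ⊆ [n]} a_S ⊗ a_{J₁} | ⋯ | a_{J_k}`. -/
def comul : H A →ₐ[ℂ] H A ⊗[ℂ] H A :=
  TensorAlgebra.lift ℂ <| DirectSum.toModule ℂ ℕ (H A ⊗[ℂ] H A) fun n =>
    PiTensorProduct.lift (∑ S : Finset (Fin (n + 1)), coprodTermMultilinear S)

/-- The coproduct on words. -/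
theorem comul_word (n : ℕ) (a : Fin n → A) (hn : 1 ≤ n) :
    comul (word (List.ofFn a)) = ∑ S : Finset (Fin n),
      word ((subsetList S).map a) ⊗ₜ[ℂ] barWord a (gaps S) := by
  obtain ⟨n, rfl⟩ : ∃ m, n = m + 1 := ⟨n - 1, by omega⟩
  rw [word_ofFn, comul, TensorAlgebra.lift_ι_apply, DirectSum.toModule_lof,
    PiTensorProduct.lift.tprod, sum_apply]
  rfl

/-- The counit of `H`: it maps `𝟏` to `1` and vanishes on `H₊ = T₊(T₊(A))`. -/
def counit : H A →ₐ[ℂ] ℂ := TensorAlgebra.algebraMapInv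

variable {B : Type*} [CommRing B] [Algebra ℂ B]

/-- The convolution product `f ⋆ g = m_B (f ⊗ g) Δ` on `Hom(H, B)`. -/
def star (f g : H A →ₗ[ℂ] B) : H A →ₗ[ℂ] B :=
  LinearMap.mul' ℂ B ∘ₗ TensorProduct.map f g ∘ₗ comul.toLinearMap

/-- The unit of `Hom(H, B)`, the counit followed by the inclusion of scalars. -/
def starUnit : H A →ₗ[ℂ] B := Algebra.linearMap ℂ B ∘ₗ counit.toLinearMap

/-- The powers `f^{⋆ k}`. -/
def starPow (f : H A →ₗ[ℂ] B) : ℕ → (H A →ₗ[ℂ] B)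
  | 0 => starUnit
  | k + 1 => star f (starPow f k)

/-- `exp^⋆(f) = ∑_{k ≥ 0} f^{⋆ k} / k!`. For an infinitesimal character `f` only finitely many
terms are nonzero at any given element of `H`. -/
def starExp (f : H A →ₗ[ℂ] B) (x : H A) : B :=
  ∑ᶠ k : ℕ, (1 / (k.factorial : ℂ)) • starPow f k x

/-- Infinitesimal characters: `f(𝟏) = 0` and `f(w₁ | w₂) = 0` for `w₁, w₂ ∈ H₊`, the augmentation
ideal `T₊(T₊(A))` of `H`. -/
def IsInfinitesimalCharacter (f : H A →ₗ[ℂ] B) : Prop :=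
  f 1 = 0 ∧ ∀ x y : H A, counit x = 0 → counit y = 0 → f (x * y) = 0

/-- The character `H → B` extending a linear map `f : A → B`: it is multiplicative and
maps a word `a₁ ⋯ a_n` to `f(a₁ ⋯ a_n)`, the value of `f` at the product in `A`. -/
def charExt (f : A →ₗ[ℂ] B) : H A →ₐ[ℂ] B :=
  TensorAlgebra.lift ℂ <| DirectSum.toModule ℂ ℕ B fun n =>
    PiTensorProduct.lift (f.compMultilinearMap (MultilinearMap.mkPiAlgebraFin ℂ (n + 1) A))

theorem charExt_word (f : A →ₗ[ℂ] B) (n : ℕ) (a : Fin n → A) (hn : 1 ≤ n) :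
    charExt f (word (List.ofFn a)) = f (List.ofFn a).prod := by
  obtain ⟨n, rfl⟩ : ∃ m, n = m + 1 := ⟨n - 1, by omega⟩
  rw [word_ofFn, charExt, TensorAlgebra.lift_ι_apply, DirectSum.toModule_lof,
    PiTensorProduct.lift.tprod, LinearMap.compMultilinearMap_apply,
    MultilinearMap.mkPiAlgebraFin_apply]

end Hopf

/-! ### Grassmann numbers -/

/-- The Grassmann algebra `𝔾 = {z + ħ w}` with `ħ² = 0`. -/
abbrev Grassmann : Type := DualNumber ℂ

section Grassmann

variable {V : Type*} [AddCommGroup V] [Module ℂ V]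

/-- The `𝔾`-valued linear map `f̃ = f + ħ f'`. -/
def tilde (f f' : V →ₗ[ℂ] ℂ) : V →ₗ[ℂ] Grassmann :=
  (TrivSqZeroExt.inlAlgHom ℂ ℂ ℂ).toLinearMap ∘ₗ f + TrivSqZeroExt.inrHom ℂ ℂ ∘ₗ f'

theorem tilde_apply (f f' : V →ₗ[ℂ] ℂ) (x : V) :
    tilde f f' x = TrivSqZeroExt.inl (f x) + f' x • DualNumber.eps := by
  simp [tilde, DualNumber.inr_eq_smul_eps]

variable {A : Type*} [Ring A] [Algebra ℂ A]

/-- The `𝔾`-valued character `Φ̃ = Φ + ħ Φ'` on `H`, the multiplicative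
extension of `φ̃ = φ + ħ φ'`. -/
def PhiTilde (φ φ' : A →ₗ[ℂ] ℂ) : H A →ₐ[ℂ] Grassmann := charExt (tilde φ φ')

/-- The extension `Φ : H → ℂ` of `φ`. -/
def Phi (φ : A →ₗ[ℂ] ℂ) : H A →ₐ[ℂ] ℂ := charExt φ

/-- The extension `Φ' : H → ℂ` of `φ'`. -/
def PhiPrime (φ φ' : A →ₗ[ℂ] ℂ) : H A →ₗ[ℂ] ℂ :=
  TrivSqZeroExt.sndHom ℂ ℂ ∘ₗ (PhiTilde φ φ').toLinearMap

/-- `Φ̃ = Φ + ħ Φ'`. -/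
theorem PhiTilde_eq (φ φ' : A →ₗ[ℂ] ℂ) :
    (PhiTilde φ φ').toLinearMap = tilde (Phi φ).toLinearMap (PhiPrime φ φ') := by
  have h : (TrivSqZeroExt.fstHom ℂ ℂ ℂ).comp (PhiTilde φ φ') = Phi φ := by
    apply TensorAlgebra.hom_ext
    refine DirectSum.linearMap_ext _ fun n => ?_
    refine PiTensorProduct.ext ?_
    ext a
    simp [PhiTilde, Phi, charExt, tilde]
  ext x
  · have := DFunLike.congr_fun h x
    simpa [tilde] using this
  · simp [tilde, PhiPrime]

/-- `Φ'(a₁ ⋯ a_n) = φ'(a₁ ⋯ a_n)`. -/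
theorem PhiPrime_word (φ φ' : A →ₗ[ℂ] ℂ) (n : ℕ) (a : Fin n → A) (hn : 1 ≤ n) :
    PhiPrime φ φ' (word (List.ofFn a)) = φ' (List.ofFn a).prod := by
  simp [PhiPrime, PhiTilde, charExt_word _ n a hn, tilde]

/-- `Φ'(w₁ | w₂) = Φ(w₁) Φ'(w₂) + Φ'(w₁) Φ(w₂)`. -/
theorem PhiPrime_mul (φ φ' : A →ₗ[ℂ] ℂ) (x y : H A) :
    PhiPrime φ φ' (x * y) = Phi φ x * PhiPrime φ φ' y + PhiPrime φ φ' x * Phi φ y := by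
  have h : ∀ z, (PhiTilde φ φ' z).fst = Phi φ z := fun z => by
    have := congrArg TrivSqZeroExt.fst (LinearMap.congr_fun (PhiTilde_eq φ φ') z)
    simpa [tilde] using this
  simp [PhiPrime, h, mul_comm]

end Grassmann

end InfMonotone

end

open scoped TensorProduct BigOperators

noncomputable section

namespace InfMonotone

/-! ### Cutting lists into pieces. -/

section ListLemmas

/-! An infinitesimal character `f` is a derivation relative to the counit, so left convolution by
`f` acts on one bar factor at a time. On a word, each factor of `f^{⋆k}` therefore removes one
nonempty set of positions lying in a single gap left by the sets removed before (`star_gaps`). The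
sequences of such sets that exhaust `[n]` are exactly the blocks of monotone partitions, listed by
label (`isAdmissibleSeq_blockSeq`). Hence `exp^⋆(f)(a₁⋯aₙ)` is the sum over `M(n)` of `(1/|π|!) ∏
f(a_V)` (`starExp_word`).

This holds over every commutative coefficient algebra, in particular over `𝔾`. For `f = ρ + ħρ'` the
scalar part expresses the moments of `φ` through `ρ`. By the hook length formula for the nesting
forest, a non-crossing `π` has `|π|!/τ(π)!` monotone labellings (`card_monotoneLabellings_mul`), so
this is the recursion defining `h`; being triangular, it forces `ρ = h` on words. By the Leibniz
rule the `ħ`-part is `φ'_n = ∑ (1/|π|!) ∂ρ_π`, with `ρ'` in the differentiated slot. Once `ρ = h`,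
this is the recursion defining `h'`, and triangularity again gives `ρ' = h'`. -/

theorem splitOnP_map {X Y : Type*} (g : X → Y) (p : Y → Bool) (l : List X) :
    (l.map g).splitOnP p = (l.splitOnP fun x => p (g x)).map (List.map g) := by
  induction l with
  | nil => simp
  | cons x l ih =>
    rw [List.map_cons, List.splitOnP_cons_eq_if_modifyHead, List.splitOnP_cons_eq_if_modifyHead, ih]
    cases hx : p (g x)
    · cases hs : l.splitOnP (fun x => p (g x)) <;> simp
    · simp

/-- Because of this, an iterated coproduct only has to remember the union of the sets removed so
far. -/
theorem splitOnP_flatMap_splitOnP {X : Type*} (p q : X → Bool) (l : List X) :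
    (l.splitOnP p).flatMap (List.splitOnP q) = l.splitOnP fun x => p x || q x := by
  induction l with
  | nil => simp
  | cons x l ih =>
    rw [List.splitOnP_cons_eq_if_modifyHead, List.splitOnP_cons_eq_if_modifyHead, ← ih]
    have hne := List.splitOnP_ne_nil (p := p) l
    cases hs : l.splitOnP p with
    | nil => exact absurd hs hne
    | cons y ys =>
      cases hx : p x
      · have hne' := List.splitOnP_ne_nil (p := q) y
        cases hy : y.splitOnP q with
        | nil => exact absurd hy hne'
        | cons z zs =>
          cases hq : q x <;> simp [hq, hy, List.splitOnP_cons_eq_if_modifyHead]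
      · simp

theorem isInfix_of_mem_splitOnP {X : Type*} (p : X → Bool) (l J : List X)
    (hJ : J ∈ l.splitOnP p) : J <:+: l := by
  -- The induction needs the first piece to be a prefix: an uncut new letter is glued onto it.
  suffices h : ∀ l : List X, (∀ J ∈ (l.splitOnP p).head?, J <+: l) ∧
      ∀ J ∈ l.splitOnP p, J <:+: l from (h l).2 J hJ
  clear hJ J l
  intro l
  induction l with
  | nil => simp
  | cons x l ih =>
    obtain ⟨ih1, ih2⟩ := ih
    rw [List.splitOnP_cons_eq_if_modifyHead]
    cases hx : p x
    · cases hs : l.splitOnP p with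
      | nil => simp
      | cons y ys =>
        rw [hs] at ih1 ih2
        have h1 : x :: y <+: x :: l := by
          rw [List.prefix_cons_inj]
          exact ih1 y (by simp)
        refine ⟨by simpa using ih1 y (by simp), fun J hJ => ?_⟩
        simp only [Bool.false_eq_true, if_false, List.modifyHead_cons, List.mem_cons] at hJ
        rcases hJ with rfl | hJ
        · exact h1.isInfix
        · exact (ih2 J (List.mem_cons_of_mem _ hJ)).trans (List.suffix_cons x l).isInfix
    · simp only [if_true, List.head?_cons, Option.mem_def, Option.some.injEq]
      refine ⟨by rintro J rfl; exact List.nil_prefix, fun J hJ => ?_⟩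
      rcases List.mem_cons.1 hJ with rfl | hJ
      · exact List.nil_infix
      · exact (ih2 J hJ).trans (List.suffix_cons x l).isInfix

theorem not_of_mem_of_mem_splitOnP {X : Type*} (p : X → Bool) (l J : List X)
    (hJ : J ∈ l.splitOnP p) (x : X) (hx : x ∈ J) : p x = false := by
  have : x ∈ (l.splitOnP p).flatten := List.mem_flatten.2 ⟨J, hJ, hx⟩
  rw [flatten_splitOnP] at this
  simpa using (List.mem_filter.1 this).2

/-- In a sorted list, a set of entries with no cut in its convex hull lies in a single piece. -/
theorem exists_mem_splitOnP {X : Type*} [LinearOrder X] (p : X → Bool) (l : List X)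
    (hl : l.Pairwise (· < ·)) (S : Finset X) (hS : ∀ s ∈ S, s ∈ l)
    (h : ∀ s ∈ S, ∀ t ∈ S, ∀ r, p r = true → s ≤ r → ¬ r ≤ t) :
    ∃ J ∈ l.splitOnP p, ∀ s ∈ S, s ∈ J := by
  -- If all of `S` precedes every cut, then `S` lies in the first piece.
  have head : ∀ (l : List X) (S : Finset X), l.Pairwise (· < ·) → (∀ s ∈ S, s ∈ l) →
      (∀ s ∈ S, ∀ r ∈ l, p r = true → s < r) →
      ∃ y ys, l.splitOnP p = y :: ys ∧ ∀ s ∈ S, s ∈ y := by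
    intro l
    induction l with
    | nil => intro S _ hS _; exact ⟨[], [], by simp, hS⟩
    | cons x l ih =>
      intro S hl hS h
      rw [List.pairwise_cons] at hl
      rw [List.splitOnP_cons_eq_if_modifyHead]
      cases hx : p x
      · obtain ⟨y, ys, he, hy⟩ := ih (S.erase x) hl.2
          (fun s hs => (List.mem_cons.1 (hS s (Finset.mem_of_mem_erase hs))).resolve_left
            (Finset.ne_of_mem_erase hs))
          (fun s hs r hr => h s (Finset.mem_of_mem_erase hs) r (List.mem_cons_of_mem _ hr))
        refine ⟨x :: y, ys, by simp [he], fun s hs => ?_⟩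
        by_cases hsx : s = x
        · simp [hsx]
        · exact List.mem_cons_of_mem _ (hy s (Finset.mem_erase.2 ⟨hsx, hs⟩))
      · refine ⟨[], l.splitOnP p, by simp, fun s hs => ?_⟩
        have h1 := h s hs x (by simp) hx
        rcases List.mem_cons.1 (hS s hs) with rfl | h2
        · exact absurd h1 (lt_irrefl _)
        · exact absurd h1 (hl.1 s h2).not_gt
  induction l with
  | nil => exact ⟨[], by simp, hS⟩
  | cons x l ih =>
    -- When the least entry belongs to `S`, no cut can precede or separate elements of `S`, so
    -- `head` applies; otherwise `x` can be dropped.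
    by_cases hxS : x ∈ S
    · obtain ⟨y, ys, he, hy⟩ := head (x :: l) S hl hS fun s hs r hr hpr => by
        have hxr : x ≤ r := by
          rcases List.mem_cons.1 hr with rfl | hr
          · exact le_rfl
          · exact ((List.pairwise_cons.1 hl).1 r hr).le
        exact not_le.1 (h x hxS s hs r hpr hxr)
      exact ⟨y, by simp [he], hy⟩
    · obtain ⟨J, hJ, hJS⟩ := ih (List.pairwise_cons.1 hl).2
        fun s hs => (List.mem_cons.1 (hS s hs)).resolve_left fun e => hxS (e ▸ hs)
      rw [List.splitOnP_cons_eq_if_modifyHead]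
      cases hx : p x
      · cases hs : l.splitOnP p with
        | nil => simp [hs] at hJ
        | cons y ys =>
          rw [hs] at hJ
          rcases List.mem_cons.1 hJ with rfl | hJ
          · exact ⟨x :: J, by simp, fun s hs => List.mem_cons_of_mem _ (hJS s hs)⟩
          · exact ⟨J, by simp [hJ], hJS⟩
      · exact ⟨J, by simp [hJ], hJS⟩

theorem mem_of_isInfix_of_between {X : Type*} [LinearOrder X] {l J : List X}
    (hl : l.Pairwise (· < ·)) (hJ : J <:+: l) {s r t : X} (hs : s ∈ J) (ht : t ∈ J) (hr : r ∈ l)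
    (hsr : s ≤ r) (hrt : r ≤ t) : r ∈ J := by
  obtain ⟨u, v, rfl⟩ := hJ
  rw [List.pairwise_append, List.pairwise_append] at hl
  rcases List.mem_append.1 hr with hr | hr
  · rcases List.mem_append.1 hr with hr | hr
    · exact absurd (hl.1.2.2 r hr s hs) hsr.not_gt
    · exact hr
  · exact absurd (hl.2.2 t (List.mem_append.2 (Or.inr ht)) r hr) hrt.not_gt

end ListLemmas

/-! ### The coproduct, and convolution by an infinitesimal character. -/

section Coproduct

variable {A : Type*} [Ring A] [Algebra ℂ A] {n : ℕ}

theorem barWord_append (a : Fin n → A) (L L' : List (List (Fin n))) :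
    barWord a (L ++ L') = barWord a L * barWord a L' := by
  simp [barWord]

theorem barWord_singleton (a : Fin n → A) (J : List (Fin n)) :
    barWord a [J] = word (J.map a) := by
  simp [barWord]

theorem counit_word (l : List A) : counit (word l) = if l = [] then 1 else 0 := by
  cases l with
  | nil => simp [word]
  | cons x l =>
    simp [word, counit, TensorAlgebra.algebraMapInv]

/-- The coproduct of the word read off along a list of positions. -/
theorem comul_word_map (a : Fin n → A) (J : List (Fin n)) (hJ : J.Nodup) :
    comul (word (J.map a)) = ∑ S ∈ J.toFinset.powerset,
      word ((J.filter fun i => decide (i ∈ S)).map a) ⊗ₜ[ℂ]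
        barWord a (J.splitOnP fun i => decide (i ∈ S)) := by
  classical
  rcases Nat.eq_zero_or_pos J.length with h0 | h0
  · obtain rfl := List.length_eq_zero_iff.1 h0
    simp [word, barWord, Algebra.TensorProduct.one_def]
  have hinj : Function.Injective J.get := List.nodup_iff_injective_get.1 hJ
  have hJl : (List.finRange J.length).map J.get = J := List.map_get_finRange J
  have h1 : J.map a = List.ofFn (a ∘ J.get) := by
    rw [List.ofFn_eq_map, ← List.map_map, hJl]
  rw [h1, comul_word _ _ h0]
  -- Subsets of indices into `J` correspond to subsets of its entries, because `J` has no
  -- repetitions.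
  refine Finset.sum_bij (fun S _ => S.map ⟨J.get, hinj⟩) ?_ ?_ ?_ ?_
  · intro S _
    rw [Finset.mem_powerset]
    intro x hx
    obtain ⟨i, -, rfl⟩ := Finset.mem_map.1 hx
    simp
  · intro S _ T _ h
    exact Finset.map_injective _ h
  · intro T hT
    refine ⟨Finset.univ.filter fun i => J.get i ∈ T, Finset.mem_univ _, ?_⟩
    ext x
    simp only [Finset.mem_map, Finset.mem_filter, Finset.mem_univ, true_and,
      Function.Embedding.coeFn_mk]
    constructor
    · rintro ⟨i, hi, rfl⟩; exact hi
    · intro hx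
      obtain ⟨i, rfl⟩ := List.mem_iff_get.1 (List.mem_toFinset.1 (Finset.mem_powerset.1 hT hx))
      exact ⟨i, hx, rfl⟩
  · intro S _
    have hp : ∀ i, decide (J.get i ∈ S.map ⟨J.get, hinj⟩) = decide (i ∈ S) := by
      intro i
      have := Finset.mem_map' (⟨J.get, hinj⟩ : Fin J.length ↪ Fin n) (a := i) (s := S)
      exact decide_eq_decide.2 this
    congr 1
    · congr 1
      have : J.filter (fun i => decide (i ∈ S.map ⟨J.get, hinj⟩)) =
          (subsetList S).map J.get := by
        conv_lhs => arg 2; rw [← hJl]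
        rw [List.filter_map]
        simp only [Function.comp_def, hp, subsetList]
      rw [this, List.map_map]
    · have : J.splitOnP (fun i => decide (i ∈ S.map ⟨J.get, hinj⟩)) =
          (gaps S).map (List.map J.get) := by
        conv_lhs => arg 2; rw [← hJl]
        rw [splitOnP_map]
        simp only [hp, gaps]
      rw [this]
      simp only [barWord, List.map_map, Function.comp_def]

/-- The left counit law. -/
theorem lid_counit_comul (x : H A) :
    Algebra.TensorProduct.lid ℂ (H A)
      (Algebra.TensorProduct.map counit (AlgHom.id ℂ (H A)) (comul x)) = x := by
  have h : ((Algebra.TensorProduct.lid ℂ (H A)).toAlgHom.comp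
      ((Algebra.TensorProduct.map counit (AlgHom.id ℂ (H A))).comp comul)) = AlgHom.id ℂ (H A) := by
    apply TensorAlgebra.hom_ext
    refine DirectSum.linearMap_ext _ fun m => ?_
    refine PiTensorProduct.ext ?_
    ext b
    have hw := comul_word (m + 1) b (by omega)
    rw [word_ofFn] at hw
    simp only [LinearMap.compMultilinearMap_apply, LinearMap.comp_apply, AlgHom.toLinearMap_apply,
      AlgHom.comp_apply, hw, map_sum]
    -- The counit kills nonempty words, so only `S = ∅` survives, where the single gap is the whole
    -- word.
    rw [Finset.sum_eq_single ∅]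
    · have : gaps (∅ : Finset (Fin (m + 1))) = [List.finRange (m + 1)] :=
        List.splitOnP_eq_singleton (by simp)
      rw [this, barWord_singleton, ← List.ofFn_eq_map]
      simp [subsetList, counit_word, ← word_ofFn]
    · intro S _ hS
      have : (subsetList S).map b ≠ [] := by
        obtain ⟨i, hi⟩ := Finset.nonempty_iff_ne_empty.2 hS
        have : i ∈ subsetList S := by simp [subsetList, hi]
        intro h
        rw [List.map_eq_nil_iff] at h
        simp [h] at this
      simp [counit_word, this]
    · simp
  exact DFunLike.congr_fun h x

variable {B : Type*} [CommRing B] [Algebra ℂ B]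

/-- Apply the vanishing condition to `x - ε(x)𝟏` and `y - ε(y)𝟏`, which lie in the augmentation
ideal, and expand. -/
theorem IsInfinitesimalCharacter.map_mul {f : H A →ₗ[ℂ] B} (hf : IsInfinitesimalCharacter f)
    (x y : H A) : f (x * y) = counit y • f x + counit x • f y := by
  have h := hf.2 (x - algebraMap ℂ _ (counit x)) (y - algebraMap ℂ _ (counit y))
    (by simp) (by simp)
  have hc : ∀ c : ℂ, f (algebraMap ℂ _ c) = 0 := fun c => by
    rw [Algebra.algebraMap_eq_smul_one, map_smul, hf.1, smul_zero]
  simp only [sub_mul, mul_sub, map_sub] at h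
  rw [← RingHom.map_mul, hc, ← Algebra.commutes, ← Algebra.smul_def, ← Algebra.smul_def, map_smul,
    map_smul] at h
  linear_combination h

/-- Left convolution by an infinitesimal character is a derivation over the bar product. -/
theorem IsInfinitesimalCharacter.star_mul {f : H A →ₗ[ℂ] B} (hf : IsInfinitesimalCharacter f)
    (g : H A →ₗ[ℂ] B) (x y : H A) :
    star f g (x * y) = star f (g ∘ₗ LinearMap.mulRight ℂ y) x +
      star f (g ∘ₗ LinearMap.mulLeft ℂ x) y := by
  set E : H A ⊗[ℂ] H A → H A := fun t => Algebra.TensorProduct.lid ℂ (H A)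
      (Algebra.TensorProduct.map counit (AlgHom.id ℂ (H A)) t) with hE
  have hEadd : ∀ s t, E (s + t) = E s + E t := fun s t => by simp [hE]
  -- Stated for arbitrary tensors, the identity is bilinear and reduces to pure tensors, where it is
  -- the derivation rule for `f`. For coproducts, `E (comul x) = x` by the counit law.
  have key : ∀ t s : H A ⊗[ℂ] H A, LinearMap.mul' ℂ B (TensorProduct.map f g (t * s)) =
      LinearMap.mul' ℂ B (TensorProduct.map f (g ∘ₗ LinearMap.mulRight ℂ (E s)) t) +
      LinearMap.mul' ℂ B (TensorProduct.map f (g ∘ₗ LinearMap.mulLeft ℂ (E t)) s) := by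
    intro t s
    have mR : ∀ u v : H A, LinearMap.mulRight ℂ (u + v) =
        LinearMap.mulRight ℂ u + LinearMap.mulRight ℂ v := fun u v => by
      ext; simp [mul_add]
    have mL : ∀ u v : H A, LinearMap.mulLeft ℂ (u + v) =
        LinearMap.mulLeft ℂ u + LinearMap.mulLeft ℂ v := fun u v => by
      ext; simp [add_mul]
    induction t using TensorProduct.induction_on with
    | zero => simp [hE]
    | add t t' h h' =>
      rw [add_mul, map_add, map_add, h, h', hEadd, mL, LinearMap.comp_add,
        TensorProduct.map_add_right, LinearMap.add_apply]
      simp only [map_add]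
      abel
    | tmul u v =>
      induction s using TensorProduct.induction_on with
      | zero => simp [hE]
      | add s s' h h' =>
        rw [mul_add, map_add, map_add, h, h', hEadd, mR, LinearMap.comp_add,
          TensorProduct.map_add_right, LinearMap.add_apply]
        simp only [map_add]
        abel
      | tmul u' v' =>
        simp [hE, hf.map_mul, add_mul]
  have := key (comul x) (comul y)
  simp only [hE, lid_counit_comul] at this
  simpa [star] using this

theorem star_word (f g : H A →ₗ[ℂ] B) (a : Fin n → A) (J : List (Fin n)) (hJ : J.Nodup) :
    star f g (word (J.map a)) = ∑ S ∈ J.toFinset.powerset,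
      f (word ((J.filter fun i => decide (i ∈ S)).map a)) *
        g (barWord a (J.splitOnP fun i => decide (i ∈ S))) := by
  simp [star, comul_word_map a J hJ]

/-- By the derivation rule `f` extracts `S` from one bar factor and leaves the others intact.
Cutting all of `L` at `S` is the same as cutting that factor, since the others are disjoint from
`S`. -/
theorem IsInfinitesimalCharacter.star_barWord {f : H A →ₗ[ℂ] B} (hf : IsInfinitesimalCharacter f)
    (g : H A →ₗ[ℂ] B) (a : Fin n → A) (L : List (List (Fin n))) (hL : L.flatten.Nodup) :
    star f g (barWord a L) = (L.map fun J => ∑ S ∈ J.toFinset.powerset,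
      f (word ((J.filter fun i => decide (i ∈ S)).map a)) *
        g (barWord a (L.flatMap (List.splitOnP fun i => decide (i ∈ S))))).sum := by
  induction L generalizing g with
  | nil => simp [barWord, star, Algebra.TensorProduct.one_def, hf.1]
  | cons J L ih =>
    rw [List.flatten_cons, List.nodup_append] at hL
    obtain ⟨hJ, hL', hd⟩ := hL
    have hc : barWord a (J :: L) = word (J.map a) * barWord a L := by simp [barWord]
    rw [hc, hf.star_mul, ih _ hL', star_word _ _ _ _ hJ, List.map_cons, List.sum_cons]
    congr 1
    · refine Finset.sum_congr rfl fun S hS => ?_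
      have : L.flatMap (List.splitOnP fun i => decide (i ∈ S)) = L := by
        rw [List.flatMap_congr (g := fun x => [x]) fun K hK => List.splitOnP_eq_singleton ?_]
        · simp
        · intro x hx
          have hxS : x ∉ S := fun h => hd x (List.mem_toFinset.1 (Finset.mem_powerset.1 hS h)) x
            (List.mem_flatten.2 ⟨K, hK, hx⟩) rfl
          simpa using hxS
      rw [List.flatMap_cons, this, barWord_append]
      simp
    · congr 1
      refine List.map_congr_left fun K hK => Finset.sum_congr rfl fun S hS => ?_
      have : J.splitOnP (fun i => decide (i ∈ S)) = [J] := by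
        refine List.splitOnP_eq_singleton fun x hx => ?_
        have hxS : x ∉ S := fun h => hd x hx x (List.mem_flatten.2
          ⟨K, hK, List.mem_toFinset.1 (Finset.mem_powerset.1 hS h)⟩) rfl
        simpa using hxS
      rw [List.flatMap_cons, this, barWord_append, barWord_singleton]
      simp

/-- `S` is a nonempty subset of one of the interval components of the complement of `R`. -/
def IsAdmissible (R S : Finset (Fin n)) : Prop :=
  S.Nonempty ∧ ∀ s ∈ S, ∀ t ∈ S, ∀ r ∈ R, s ≤ r → ¬ r ≤ t

theorem isAdmissible_iff (R S : Finset (Fin n)) :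
    IsAdmissible R S ↔ S.Nonempty ∧ ∃ J ∈ gaps R, S ⊆ J.toFinset := by
  refine and_congr_right fun _ => ⟨fun h => ?_, ?_⟩
  · obtain ⟨J, hJ, hS⟩ := exists_mem_splitOnP (fun i => decide (i ∈ R)) (List.finRange n)
      (List.pairwise_lt_finRange n) S (fun s _ => List.mem_finRange s)
      (fun s hs t ht r hr => h s hs t ht r (by simpa using hr))
    exact ⟨J, hJ, fun s hs => List.mem_toFinset.2 (hS s hs)⟩
  · rintro ⟨J, hJ, hS⟩ s hs t ht r hr hsr hrt
    have hrJ := mem_of_isInfix_of_between (List.pairwise_lt_finRange n)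
      (isInfix_of_mem_splitOnP _ _ J hJ) (List.mem_toFinset.1 (hS hs))
      (List.mem_toFinset.1 (hS ht)) (List.mem_finRange r) hsr hrt
    have := not_of_mem_of_mem_splitOnP _ _ J hJ r hrJ
    simp [hr] at this

theorem filter_eq_subsetList {R S : Finset (Fin n)} {J : List (Fin n)} (hJ : J ∈ gaps R)
    (hS : S ⊆ J.toFinset) : J.filter (fun i => decide (i ∈ S)) = subsetList S := by
  have hsub := (isInfix_of_mem_splitOnP _ _ J hJ).sublist
  have hl := List.pairwise_lt_finRange n
  refine List.Pairwise.eq_of_mem_iff (r := (· < ·)) ((hl.sublist hsub).filter _) (hl.filter _) ?_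
  intro x
  simp only [subsetList, List.mem_filter, decide_eq_true_eq, List.mem_finRange, true_and,
    and_iff_right_iff_imp]
  exact fun hx => List.mem_toFinset.1 (hS hx)

theorem nodup_flatten_gaps (R : Finset (Fin n)) : (gaps R).flatten.Nodup := by
  rw [gaps, flatten_splitOnP]
  exact (List.nodup_finRange n).filter _

open Classical in
-- A nonempty set fits into at most one of several disjoint lists, so at most one summand is
-- nonzero.
theorem sum_map_ite_subset {M : Type*} [AddCommMonoid M] (L : List (List (Fin n)))
    (hL : L.flatten.Nodup) (S : Finset (Fin n)) (hS : S.Nonempty) (c : M) :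
    (L.map fun J => if S ⊆ J.toFinset then c else 0).sum =
      if ∃ J ∈ L, S ⊆ J.toFinset then c else 0 := by
  induction L with
  | nil => simp
  | cons K L ih =>
    rw [List.flatten_cons, List.nodup_append] at hL
    obtain ⟨-, hL', hd⟩ := hL
    rw [List.map_cons, List.sum_cons, ih hL']
    by_cases hK : S ⊆ K.toFinset
    · obtain ⟨s, hs⟩ := hS
      have : ¬ ∃ J ∈ L, S ⊆ J.toFinset := by
        rintro ⟨J, hJ, hSJ⟩
        exact hd s (List.mem_toFinset.1 (hK hs)) s
          (List.mem_flatten.2 ⟨J, hJ, List.mem_toFinset.1 (hSJ hs)⟩) rfl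
      simp [hK, this]
    · simp [hK]

open Classical in
-- The one-step recursion: with the removed positions `R` as state, a convolution by `f` removes a
-- further set inside one gap and passes to `R ∪ S`.
theorem IsInfinitesimalCharacter.star_gaps {f : H A →ₗ[ℂ] B} (hf : IsInfinitesimalCharacter f)
    (g : H A →ₗ[ℂ] B) (a : Fin n → A) (R : Finset (Fin n)) :
    star f g (barWord a (gaps R)) = ∑ S : Finset (Fin n), if IsAdmissible R S then
      f (word ((subsetList S).map a)) * g (barWord a (gaps (R ∪ S))) else 0 := by
  rw [hf.star_barWord g a _ (nodup_flatten_gaps R)]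
  have hg : ∀ S : Finset (Fin n), (gaps R).flatMap (List.splitOnP fun i => decide (i ∈ S)) =
      gaps (R ∪ S) := fun S => by
    rw [gaps, splitOnP_flatMap_splitOnP, gaps]
    congr 1
    funext x
    simp [Finset.mem_union]
  set K : Finset (Fin n) → B := fun S =>
    f (word ((subsetList S).map a)) * g (barWord a (gaps (R ∪ S))) with hK
  have h1 : ∀ J ∈ gaps R, (∑ S ∈ J.toFinset.powerset,
      f (word ((J.filter fun i => decide (i ∈ S)).map a)) *
        g (barWord a ((gaps R).flatMap (List.splitOnP fun i => decide (i ∈ S))))) =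
      ∑ S : Finset (Fin n), if S ⊆ J.toFinset then K S else 0 := by
    intro J hJ
    rw [← Finset.sum_filter]
    refine Finset.sum_congr (by ext; simp) fun S hS => ?_
    rw [filter_eq_subsetList hJ (Finset.mem_filter.1 hS).2, hg]
  have swap : ∀ (L : List (List (Fin n))) (c : List (Fin n) → Finset (Fin n) → B),
      (L.map fun J => ∑ S : Finset (Fin n), c J S).sum =
        ∑ S : Finset (Fin n), (L.map fun J => c J S).sum := by
    intro L c
    induction L with
    | nil => simp
    | cons J L ih => simp [ih, Finset.sum_add_distrib]
  rw [List.map_congr_left h1, swap]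
  refine Finset.sum_congr rfl fun S _ => ?_
  -- The empty set lies in every gap, but its term vanishes because `f 1 = 0`.
  rcases S.eq_empty_or_nonempty with rfl | hS
  · have : K ∅ = 0 := by simp [hK, subsetList, word, hf.1]
    simp [this, IsAdmissible]
  · rw [sum_map_ite_subset _ (nodup_flatten_gaps R) S hS]
    simp only [isAdmissible_iff, hS, true_and]
    split_ifs <;> rfl

/-- This ends the recursion: only removals exhausting all positions contribute. -/
theorem counit_gaps (a : Fin n → A) (R : Finset (Fin n)) :
    counit (barWord a (gaps R)) = if R = Finset.univ then 1 else 0 := by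
  have h : ∀ L : List (List (Fin n)), counit (barWord a L) = if L.flatten = [] then 1 else 0 := by
    intro L
    induction L with
    | nil => simp [barWord]
    | cons J L ih =>
      have hc : barWord a (J :: L) = word (J.map a) * barWord a L := by simp [barWord]
      rw [hc, map_mul, ih, counit_word]
      by_cases hJ : J = [] <;> simp [hJ]
  rw [h, gaps, flatten_splitOnP]
  simp [List.filter_eq_nil_iff, Finset.eq_univ_iff_forall]

end Coproduct

/-! ### Convolution powers and monotone partitions. -/

section Powers

variable {n : ℕ}

theorem isAdmissible_union (R S T : Finset (Fin n)) :
    IsAdmissible (R ∪ S) T ↔ IsAdmissible R T ∧ IsAdmissible S T := by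
  simp only [IsAdmissible, Finset.mem_union]
  constructor
  · rintro ⟨h0, h⟩
    exact ⟨⟨h0, fun s hs t ht r hr => h s hs t ht r (Or.inl hr)⟩,
      h0, fun s hs t ht r hr => h s hs t ht r (Or.inr hr)⟩
  · rintro ⟨⟨h0, h⟩, -, h'⟩
    exact ⟨h0, fun s hs t ht r hr => hr.elim (h s hs t ht r) (h' s hs t ht r)⟩

/-- `V` lists nonempty sets which exhaust the complement of `R`, where the convex hull of each
one avoids `R` and the sets listed before. -/
def IsAdmissibleSeq (R : Finset (Fin n)) {k : ℕ} (V : Fin k → Finset (Fin n)) : Prop :=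
  (∀ j, IsAdmissible R (V j)) ∧ (∀ i j, i < j → IsAdmissible (V i) (V j)) ∧
    R ∪ Finset.univ.biUnion V = Finset.univ

/-- Splits off the first set in the form in which `star_gaps` changes the state. -/
theorem isAdmissibleSeq_cons (R S : Finset (Fin n)) {k : ℕ} (V : Fin k → Finset (Fin n)) :
    IsAdmissibleSeq R (Fin.cons S V : Fin (k + 1) → Finset (Fin n)) ↔
      IsAdmissible R S ∧ IsAdmissibleSeq (R ∪ S) V := by
  have hU : Finset.univ.biUnion (Fin.cons S V : Fin (k + 1) → Finset (Fin n)) =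
      S ∪ Finset.univ.biUnion V := by
    ext x
    simp [Fin.exists_fin_succ]
  simp only [IsAdmissibleSeq, hU, Fin.forall_fin_succ, Fin.cons_zero, Fin.cons_succ,
    Fin.succ_lt_succ_iff, isAdmissible_union, Finset.union_assoc, Fin.succ_pos,
    Fin.not_lt_zero, false_imp_iff, forall_const, forall_and]
  tauto

variable {A : Type*} [Ring A] [Algebra ℂ A] {B : Type*} [CommRing B] [Algebra ℂ B]

open Classical in
theorem IsInfinitesimalCharacter.starPow_gaps {f : H A →ₗ[ℂ] B} (hf : IsInfinitesimalCharacter f)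
    (a : Fin n → A) (k : ℕ) (R : Finset (Fin n)) :
    starPow f k (barWord a (gaps R)) = ∑ V : Fin k → Finset (Fin n),
      if IsAdmissibleSeq R V then ∏ j, f (word ((subsetList (V j)).map a)) else 0 := by
  induction k generalizing R with
  | zero =>
    simp only [starPow, starUnit, LinearMap.comp_apply, AlgHom.toLinearMap_apply, counit_gaps]
    by_cases hR : R = Finset.univ <;> simp [IsAdmissibleSeq, hR]
  | succ k ih =>
    rw [starPow, hf.star_gaps, ← (Fin.consEquiv fun _ => Finset (Fin n)).sum_comp,
      Fintype.sum_prod_type]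
    refine Finset.sum_congr rfl fun S _ => ?_
    rw [ih, Finset.mul_sum]
    have hc : ∀ V : Fin k → Finset (Fin n), (Fin.consEquiv fun _ => Finset (Fin n)) (S, V) =
        (Fin.cons S V : Fin (k + 1) → Finset (Fin n)) := fun _ => rfl
    simp only [hc, isAdmissibleSeq_cons]
    by_cases hS : IsAdmissible R S
    · rw [if_pos hS]
      refine Finset.sum_congr rfl fun V _ => ?_
      simp only [hS, true_and, Fin.prod_univ_succ, Fin.cons_zero, Fin.cons_succ, mul_ite, mul_zero]
    · rw [if_neg hS, Finset.sum_eq_zero]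
      intro V _
      simp [hS]

theorem IsAdmissibleSeq.disjoint {R : Finset (Fin n)} {k : ℕ} {V : Fin k → Finset (Fin n)}
    (hV : IsAdmissibleSeq R V) {i j : Fin k} (hij : i ≠ j) : Disjoint (V i) (V j) := by
  have key : ∀ i j, i < j → Disjoint (V i) (V j) := fun i j h =>
    Finset.disjoint_left.2 fun x hi hj => (hV.2.1 i j h).2 x hj x hj x hi le_rfl le_rfl
  rcases hij.lt_or_gt with h | h
  · exact key i j h
  · exact (key j i h).symm

theorem IsAdmissibleSeq.injective {R : Finset (Fin n)} {k : ℕ} {V : Fin k → Finset (Fin n)}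
    (hV : IsAdmissibleSeq R V) : Function.Injective V := by
  intro i j h
  by_contra hij
  have := hV.disjoint hij
  rw [h, disjoint_self] at this
  exact (hV.1 j).1.ne_empty this

/-- The sets are nonempty and disjoint, so a point chosen from each gives an injection into `Fin n`.
This makes the exponential series finite on words. -/
theorem IsAdmissibleSeq.le {R : Finset (Fin n)} {k : ℕ} {V : Fin k → Finset (Fin n)}
    (hV : IsAdmissibleSeq R V) : k ≤ n := by
  choose v hv using fun j => (hV.1 j).1
  have : Function.Injective v := by
    intro i j h
    by_contra hij
    exact Finset.disjoint_left.1 (hV.disjoint hij) (hv i) (h ▸ hv j)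
  simpa using Fintype.card_le_of_injective v this

/-- Listing the blocks of a set partition in the order of a labelling. -/
def blockSeq (p : (π : SetPartition n) × (π.parts ≃ Fin π.parts.card)) :
    (k : ℕ) × (Fin k → Finset (Fin n)) :=
  ⟨p.1.parts.card, fun j => (p.2.symm j).1⟩

theorem blockSeq_injective : Function.Injective (blockSeq (n := n)) := by
  rintro ⟨π, lam⟩ ⟨π', lam'⟩ h
  have hr : ∀ p : (π : SetPartition n) × (π.parts ≃ Fin π.parts.card),
      Set.range (blockSeq p).2 = (p.1.parts : Set (Finset (Fin n))) := by
    rintro ⟨π, lam⟩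
    ext x
    constructor
    · rintro ⟨j, rfl⟩; exact (lam.symm j).2
    · intro hx; exact ⟨lam ⟨x, hx⟩, by simp [blockSeq]⟩
  have h1 := hr ⟨π, lam⟩
  rw [h, hr] at h1
  obtain rfl : π' = π := Finpartition.ext (Finset.coe_injective h1)
  congr 1
  have h2 := eq_of_heq (Sigma.mk.inj h).2
  have : lam.symm = lam'.symm := by
    ext j : 1
    exact Subtype.ext (congrFun h2 j)
  exact Equiv.symm_bijective.injective this

theorem exists_blockSeq_eq (π : SetPartition n) (k : ℕ) (hk : π.parts.card = k)
    (V : Fin k → Finset (Fin n)) (hV : Function.Injective V) (hm : ∀ j, V j ∈ π.parts) :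
    ∃ lam, blockSeq ⟨π, lam⟩ = ⟨k, V⟩ := by
  subst hk
  have hb : Function.Bijective fun j => (⟨V j, hm j⟩ : π.parts) := by
    rw [Fintype.bijective_iff_injective_and_card]
    exact ⟨fun i j h => hV (congrArg Subtype.val h), by simp⟩
  exact ⟨(Equiv.ofBijective _ hb).symm, rfl⟩

/-- Admissibility says that an earlier block misses the convex hull of a later one. Crossing blocks
meet each other's hulls, and a nested block meets the hull of the outer one, so it must come later.
Conversely, a block meeting the hull of another without crossing it is nested inside it, hence has
the larger label. -/
theorem isAdmissibleSeq_blockSeq (p : (π : SetPartition n) × (π.parts ≃ Fin π.parts.card)) :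
    IsAdmissibleSeq ∅ (blockSeq p).2 ↔ p ∈ MonotonePartitions n := by
  obtain ⟨π, lam⟩ := p
  have hne : ∀ V ∈ π.parts, V.Nonempty := fun V hV => π.nonempty_of_mem_parts hV
  have hun : Finset.univ.biUnion (blockSeq ⟨π, lam⟩).2 = Finset.univ := by
    ext x
    simp only [Finset.mem_biUnion, Finset.mem_univ, true_and, iff_true]
    obtain ⟨V, hV, hx⟩ := π.exists_mem (Finset.mem_univ x)
    exact ⟨lam ⟨V, hV⟩, by simpa [blockSeq] using hx⟩
  have h0 : IsAdmissibleSeq ∅ (blockSeq ⟨π, lam⟩).2 ↔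
      ∀ V W : π.parts, lam V < lam W → IsAdmissible V.1 W.1 := by
    simp only [IsAdmissibleSeq, hun, Finset.empty_union, and_true]
    constructor
    · intro h V W hVW
      simpa [blockSeq] using h.2 _ _ hVW
    · intro h
      refine ⟨fun j => ⟨hne _ (lam.symm j).2, by simp⟩, fun i j hij => h _ _ ?_⟩
      exact lt_of_eq_of_lt (lam.apply_symm_apply i)
        (lt_of_lt_of_eq hij (lam.apply_symm_apply j).symm)
  have h1 : (⟨π, lam⟩ : (π : SetPartition n) × (π.parts ≃ Fin π.parts.card)) ∈
      MonotonePartitions n ↔ IsNonCrossing π ∧ IsMonotoneLabelling π lam := by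
    simp [MonotonePartitions, NC]
  rw [h0, h1]
  constructor
  · intro h
    have h' : ∀ V W : π.parts, V ≠ W → IsAdmissible V.1 W.1 ∨ IsAdmissible W.1 V.1 := by
      intro V W hne
      rcases (lam.injective.ne hne).lt_or_gt with h1 | h1
      · exact Or.inl (h _ _ h1)
      · exact Or.inr (h _ _ h1)
    constructor
    · intro V hV W hW i j k l hij hjk hkl hi hk hj hl
      by_contra hne
      rcases h' ⟨V, hV⟩ ⟨W, hW⟩ (by simpa using hne) with h1 | h1
      · exact h1.2 j hj l hl k hk hjk.le hkl.le
      · exact h1.2 i hi k hk j hj hij.le hjk.le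
    · rintro V W ⟨hVW, i, hi, j, hj, hv⟩
      rcases (lam.injective.ne (Subtype.coe_ne_coe.1 hVW)).lt_or_gt with h1 | h1
      · obtain ⟨v, hvV⟩ := hne V.1 V.2
        exact absurd (hv v hvV).2.le ((h _ _ h1).2 i hi j hj v hvV (hv v hvV).1.le)
      · exact h1
  · rintro ⟨hnc, hmon⟩ V W hVW
    refine ⟨hne _ W.2, fun s hs t ht r hr hsr hrt => ?_⟩
    have hVW' : V.1 ≠ W.1 := fun h => hVW.ne (congrArg lam (Subtype.ext h))
    have hd : ∀ x ∈ V.1, ∀ y ∈ W.1, x ≠ y := fun x hx y hy hxy =>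
      Finset.disjoint_left.1 (π.disjoint V.2 W.2 hVW') hx (hxy ▸ hy)
    have hsr' : s < r := lt_of_le_of_ne hsr (hd r hr s hs).symm
    have hrt' : r < t := lt_of_le_of_ne hrt (hd r hr t ht)
    refine absurd (hmon V W ⟨hVW', s, hs, t, ht, fun v hv => ⟨?_, ?_⟩⟩) hVW.not_gt
    · by_contra hc
      have : v < s := lt_of_le_of_ne (not_lt.1 hc) (hd v hv s hs)
      exact hVW' (hnc _ V.2 _ W.2 v s r t this hsr' hrt' hv hr hs ht)
    · by_contra hc
      have : t < v := lt_of_le_of_ne (not_lt.1 hc) (hd v hv t ht).symm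
      exact hVW' (hnc _ W.2 _ V.2 s r t v hsr' hrt' this hs ht hr hv).symm

theorem IsAdmissibleSeq.exists_blockSeq_eq {k : ℕ} {V : Fin k → Finset (Fin n)}
    (hV : IsAdmissibleSeq ∅ V) : ∃ p, blockSeq p = ⟨k, V⟩ := by
  let π : SetPartition n :=
    { parts := Finset.univ.image V
      supIndep := by
        rw [Finset.supIndep_iff_pairwiseDisjoint]
        intro x hx y hy hxy
        obtain ⟨i, -, rfl⟩ := Finset.mem_image.1 hx
        obtain ⟨j, -, rfl⟩ := Finset.mem_image.1 hy
        exact hV.disjoint fun h => hxy (congrArg V h)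
      sup_parts := by
        have := hV.2.2
        rw [Finset.empty_union] at this
        rw [Finset.sup_image, Function.id_comp, Finset.sup_eq_biUnion, this]
      bot_notMem := by
        intro h
        obtain ⟨i, -, hi⟩ := Finset.mem_image.1 h
        exact (hV.1 i).1.ne_empty hi }
  obtain ⟨lam, h⟩ := InfMonotone.exists_blockSeq_eq π k
    (by simp [π, Finset.card_image_of_injective _ hV.injective]) V hV.injective
    (fun j => Finset.mem_image_of_mem _ (Finset.mem_univ j))
  exact ⟨⟨π, lam⟩, h⟩

/-- The convolution exponential of an infinitesimal character as a sum over monotone partitions. -/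
theorem IsInfinitesimalCharacter.starExp_word {f : H A →ₗ[ℂ] B} (hf : IsInfinitesimalCharacter f)
    (a : Fin n → A) : starExp f (word (List.ofFn a)) = ∑ p ∈ MonotonePartitions n,
      (1 / (p.1.parts.card.factorial : ℂ)) •
        ∏ V ∈ p.1.parts, f (word ((subsetList V).map a)) := by
  classical
  have hw : word (List.ofFn a) = barWord a (gaps ∅) := by
    have : gaps (∅ : Finset (Fin n)) = [List.finRange n] :=
      List.splitOnP_eq_singleton (by simp)
    rw [this, barWord_singleton, ← List.ofFn_eq_map]
  simp only [starExp, hw, hf.starPow_gaps]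
  -- Powers beyond `n` vanish on a word of length `n`, as no admissible sequence is that long.
  rw [finsum_eq_sum_of_support_subset (s := Finset.range (n + 1))]
  · simp only [← Finset.sum_filter, Finset.smul_sum]
    rw [Finset.sum_sigma']
    symm
    refine Finset.sum_bij (fun p _ => blockSeq p) ?_ ?_ ?_ ?_
    · intro p hp
      have := (isAdmissibleSeq_blockSeq p).2 hp
      simpa [Nat.lt_succ_iff] using ⟨this.le, this⟩
    · intro p _ q _ h
      exact blockSeq_injective h
    · rintro ⟨k, V⟩ hV
      simp only [Finset.mem_sigma, Finset.mem_filter, Finset.mem_univ, true_and] at hV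
      obtain ⟨p, hp⟩ := hV.2.exists_blockSeq_eq
      refine ⟨p, (isAdmissibleSeq_blockSeq p).1 ?_, hp⟩
      rw [hp]; exact hV.2
    · rintro ⟨π, lam⟩ _
      simp only [blockSeq]
      congr 1
      rw [← Finset.prod_coe_sort, ← lam.symm.prod_comp]
      rfl
  · intro k hk
    rw [Finset.mem_coe, Finset.mem_range, Nat.lt_succ_iff]
    by_contra hn
    refine hk ?_
    dsimp only
    rw [Finset.sum_eq_zero, smul_zero]
    intro V _
    rw [if_neg]
    exact fun hV => hn hV.le

end Powers

/-! ### The hook length formula for forests. -/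

section Hook

variable {α : Type*}

/-- The injective sequences in `P` in which no member is below a later one. -/
def IsCompatibleSeq (r : α → α → Prop) (P : Finset α) {k : ℕ} (V : Fin k → α) : Prop :=
  (∀ j, V j ∈ P) ∧ Function.Injective V ∧ ∀ i j, i < j → ¬ r (V i) (V j)

/-- The sequence has as many members as `P`, so its tail exhausts `P.erase x`. Its first member is
therefore a root: it lies below no other element of `P`. -/
theorem isCompatibleSeq_cons [DecidableEq α] (r : α → α → Prop) {k : ℕ} (P : Finset α)
    (hP : P.card = k + 1) (x : α) (V : Fin k → α) :
    IsCompatibleSeq r P (Fin.cons x V : Fin (k + 1) → α) ↔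
      (x ∈ P ∧ ∀ y ∈ P.erase x, ¬ r x y) ∧ IsCompatibleSeq r (P.erase x) V := by
  simp only [IsCompatibleSeq, Fin.forall_fin_succ, Fin.cons_zero, Fin.cons_succ,
    Fin.succ_lt_succ_iff, Fin.succ_pos, Fin.not_lt_zero, false_imp_iff, forall_const, forall_and,
    Fin.cons_injective_iff, Set.mem_range, not_exists, Finset.mem_erase, true_and]
  constructor
  · rintro ⟨⟨hx, hV⟩, ⟨hxV, hinj⟩, hr, hc⟩
    refine ⟨⟨hx, fun y hy => ?_⟩, ⟨hxV, hV⟩, hinj, hc⟩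
    have himg : Finset.univ.image V = P.erase x := by
      refine Finset.eq_of_subset_of_card_le (fun z hz => ?_) ?_
      · obtain ⟨j, -, rfl⟩ := Finset.mem_image.1 hz
        exact Finset.mem_erase.2 ⟨hxV j, hV j⟩
      · rw [Finset.card_image_of_injective _ hinj, Finset.card_erase_of_mem hx, hP]
        simp
    obtain ⟨j, -, rfl⟩ := Finset.mem_image.1 (himg ▸ Finset.mem_erase.2 hy)
    exact hr j
  · rintro ⟨⟨hx, hr⟩, ⟨hxV, hV⟩, hinj, hc⟩
    exact ⟨⟨hx, hV⟩, ⟨hxV, hinj⟩, fun j => hr _ ⟨hxV j, hV j⟩, hc⟩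

open Classical in
/-- The compatible sequences of length `k` in `P`. -/
def compatibleSeqs [Fintype α] (r : α → α → Prop) (k : ℕ) (P : Finset α) : Finset (Fin k → α) :=
  Finset.univ.filter (IsCompatibleSeq r P)

theorem mem_compatibleSeqs [Fintype α] {r : α → α → Prop} {k : ℕ} {P : Finset α} {V : Fin k → α} :
    V ∈ compatibleSeqs r k P ↔ IsCompatibleSeq r P V := by
  simp [compatibleSeqs]

open Classical in
/-- The members of `P` which are equal to or below `x`. -/
def hook (r : α → α → Prop) (P : Finset α) (x : α) : Finset α :=
  P.filter fun y => y = x ∨ r y x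

theorem mem_hook {r : α → α → Prop} {P : Finset α} {x y : α} :
    y ∈ hook r P x ↔ y ∈ P ∧ (y = x ∨ r y x) := by
  simp [hook]

open Classical in
theorem card_compatibleSeqs_succ [Fintype α] (r : α → α → Prop) (k : ℕ) (P : Finset α) (hP : P.card = k + 1) :
    (compatibleSeqs r (k + 1) P).card =
      ∑ x ∈ P.filter (fun x => ∀ y ∈ P.erase x, ¬ r x y), (compatibleSeqs r k (P.erase x)).card := by
  have hT : P.filter (fun x => ∀ y ∈ P.erase x, ¬ r x y) =
      Finset.univ.filter fun x => x ∈ P ∧ ∀ y ∈ P.erase x, ¬ r x y := by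
    ext x; simp
  rw [hT]
  simp only [compatibleSeqs, Finset.card_filter]
  rw [← (Fin.consEquiv fun _ => α).sum_comp, Fintype.sum_prod_type, Finset.sum_filter]
  refine Finset.sum_congr rfl fun x _ => ?_
  have hc : ∀ V : Fin k → α, (Fin.consEquiv fun _ => α) (x, V) =
      (Fin.cons x V : Fin (k + 1) → α) := fun _ => rfl
  simp only [hc, isCompatibleSeq_cons r P hP]
  by_cases hx : x ∈ P ∧ ∀ y ∈ P.erase x, ¬ r x y
  · rw [if_pos hx]
    exact Finset.sum_congr rfl fun V _ => if_congr (and_iff_right hx) rfl rfl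
  · rw [if_neg hx]
    exact Finset.sum_eq_zero fun V _ => if_neg fun h => hx h.1

open Classical in
/-- The hook length formula for forests. -/
theorem card_compatibleSeqs_mul [Fintype α] (r : α → α → Prop) (hirr : ∀ x, ¬ r x x)
    (htr : ∀ x y z, r x y → r y z → r x z)
    (hforest : ∀ x y z, r x y → r x z → y ≠ z → r y z ∨ r z y) (k : ℕ) (P : Finset α)
    (hP : P.card = k) :
    (compatibleSeqs r k P).card * ∏ x ∈ P, (hook r P x).card =
      k.factorial := by
  induction k generalizing P with
  | zero =>
    obtain rfl := Finset.card_eq_zero.1 hP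
    have h : compatibleSeqs r 0 ∅ = Finset.univ := by
      ext V
      exact iff_of_true (mem_compatibleSeqs.2 ⟨fun j => j.elim0, fun j => j.elim0, fun j => j.elim0⟩)
        (Finset.mem_univ _)
    simp [h]
  | succ k ih =>
    set T := P.filter (fun x => ∀ y ∈ P.erase x, ¬ r x y) with hT
    -- The hooks of the roots `T` partition `P`: finiteness puts each element below some root, and
    -- the forest condition excludes two.
    have hroots : ∑ x ∈ T, (hook r P x).card = k + 1 := by
      rw [← Finset.card_biUnion, ← hP]
      · congr 1
        ext y
        simp only [Finset.mem_biUnion, mem_hook]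
        refine ⟨fun ⟨x, _, hy, _⟩ => hy, fun hy => ?_⟩
        have : IsTrans α (Function.swap r) := ⟨fun a b c hab hbc => htr _ _ _ hbc hab⟩
        have : Std.Irrefl (Function.swap r) := ⟨hirr⟩
        have hwf : WellFounded (Function.swap r) := Finite.wellFounded_of_trans_of_irrefl _
        obtain ⟨x, ⟨hx, hyx⟩, hmin⟩ := hwf.has_min {x | x ∈ P ∧ (y = x ∨ r y x)} ⟨y, hy, Or.inl rfl⟩
        refine ⟨x, Finset.mem_filter.2 ⟨hx, fun z hz hxz => hmin z ⟨Finset.mem_of_mem_erase hz, ?_⟩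
          hxz⟩, hy, hyx⟩
        rcases hyx with rfl | hyx
        · exact Or.inr hxz
        · exact Or.inr (htr _ _ _ hyx hxz)
      · intro x hx z hz hxz
        have hx' := Finset.mem_filter.1 hx
        have hz' := Finset.mem_filter.1 hz
        have h1 : ¬ r x z := hx'.2 z (Finset.mem_erase.2 ⟨hxz.symm, hz'.1⟩)
        have h2 : ¬ r z x := hz'.2 x (Finset.mem_erase.2 ⟨hxz, hx'.1⟩)
        refine Finset.disjoint_left.2 fun y hy hy' => ?_
        rcases (mem_hook.1 hy).2 with rfl | ha
        · rcases (mem_hook.1 hy').2 with rfl | hb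
          · exact hxz rfl
          · exact h1 hb
        · rcases (mem_hook.1 hy').2 with rfl | hb
          · exact h2 ha
          · rcases hforest _ _ _ ha hb hxz with h | h
            · exact h1 h
            · exact h2 h
    -- Sum over the first member `x`, a root: each term becomes `k!` times the hook size of `x`, and
    -- these sizes add up to `k + 1`.
    rw [card_compatibleSeqs_succ r k P hP, Finset.sum_mul, Nat.factorial_succ, ← hroots,
      Finset.sum_mul]
    refine Finset.sum_congr rfl fun x hx => ?_
    obtain ⟨hxP, hroot⟩ := Finset.mem_filter.1 hx
    rw [← ih (P.erase x) (by rw [Finset.card_erase_of_mem hxP, hP]; rfl),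
      ← Finset.mul_prod_erase P _ hxP, mul_left_comm]
    congr 2
    -- Deleting a root changes no other hook, since it lies below nothing.
    refine Finset.prod_congr rfl fun z hz => ?_
    congr 1
    ext y
    simp only [mem_hook, Finset.mem_erase]
    refine ⟨fun ⟨h1, h2⟩ => ⟨⟨?_, h1⟩, h2⟩, fun ⟨⟨_, h1⟩, h2⟩ => ⟨h1, h2⟩⟩
    rintro rfl
    rcases h2 with rfl | h2
    · exact Finset.ne_of_mem_erase hz rfl
    · exact hroot z hz h2

end Hook

/-! ### Counting the monotone labellings of a non-crossing partition. -/

section Labellings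

variable {n : ℕ}

/-- Two blocks surrounding a common point must be nested, the one reaching further left outside; any
element of `W` outside the hull of `V` would produce a crossing. -/
theorem IsNonCrossing.isNested_of_lt {π : SetPartition n} (hπ : IsNonCrossing π)
    {V W : Finset (Fin n)} (hV : V ∈ π.parts) (hW : W ∈ π.parts) (hVW : V ≠ W)
    {i j i' j' v : Fin n} (hi : i ∈ V) (hj : j ∈ V) (hi' : i' ∈ W) (hj' : j' ∈ W)
    (hv : i < v ∧ v < j) (hv' : i' < v ∧ v < j') (hii : i < i') : IsNested W V := by
  have hd : ∀ x ∈ V, ∀ y ∈ W, x ≠ y := fun x hx y hy hxy =>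
    Finset.disjoint_left.1 (π.disjoint hV hW hVW) hx (hxy ▸ hy)
  refine ⟨hVW.symm, i, hi, j, hj, fun w hw => ⟨?_, ?_⟩⟩
  · by_contra hc
    have h1 : w < i := lt_of_le_of_ne (not_lt.1 hc) (hd i hi w hw).symm
    have h2 : j' < j := by
      by_contra hc
      have h2 : j < j' := lt_of_le_of_ne (not_lt.1 hc) (hd j hj j' hj')
      exact hVW (hπ V hV W hW i i' j j' hii (hv'.1.trans hv.2) h2 hi hj hi' hj')
    exact hVW (hπ W hW V hV w i j' j h1 (hv.1.trans hv'.2) h2 hw hj' hi hj).symm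
  · by_contra hc
    have h1 : j < w := lt_of_le_of_ne (not_lt.1 hc) (hd j hj w hw)
    exact hVW (hπ V hV W hW i i' j w hii (hv'.1.trans hv.2) h1 hi hj hi' hw)

open Classical in
-- Nesting orders the blocks as a forest, monotone labellings are its linear extensions, and `N(V)`
-- is the hook size of `V`.
theorem card_monotoneLabellings_mul (π : SetPartition n) (hπ : IsNonCrossing π) :
    (Finset.univ.filter (IsMonotoneLabelling π)).card * treeFactorial π =
      π.parts.card.factorial := by
  have hne : ∀ V ∈ π.parts, V.Nonempty := fun V hV => π.nonempty_of_mem_parts hV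
  have hd : ∀ V ∈ π.parts, ∀ W ∈ π.parts, V ≠ W → ∀ x ∈ V, ∀ y ∈ W, x ≠ y :=
    fun V hV W hW h x hx y hy hxy => Finset.disjoint_left.1 (π.disjoint hV hW h) hx (hxy ▸ hy)
  let r : π.parts → π.parts → Prop := fun V W => IsNested V.1 W.1
  have hirr : ∀ x, ¬ r x x := fun x h => h.1 rfl
  have htr : ∀ x y z, r x y → r y z → r x z := by
    rintro x y z ⟨-, i, hi, j, hj, h⟩ ⟨-, i', hi', j', hj', h'⟩
    have hlt : ∀ v ∈ x.1, i' < v ∧ v < j' := fun v hv =>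
      ⟨(h' i hi).1.trans (h v hv).1, (h v hv).2.trans (h' j hj).2⟩
    refine ⟨fun e => ?_, i', hi', j', hj', hlt⟩
    exact lt_irrefl _ (hlt i' (e ▸ hi')).1
  have hforest : ∀ x y z, r x y → r x z → y ≠ z → r y z ∨ r z y := by
    rintro x y z ⟨-, i, hi, j, hj, h⟩ ⟨-, i', hi', j', hj', h'⟩ hyz
    have hyz' : y.1 ≠ z.1 := fun e => hyz (Subtype.ext e)
    obtain ⟨v, hv⟩ := hne _ x.2
    rcases lt_trichotomy i i' with hii | rfl | hii
    · exact Or.inr (hπ.isNested_of_lt y.2 z.2 hyz' hi hj hi' hj' (h v hv) (h' v hv) hii)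
    · exact absurd rfl (hd _ y.2 _ z.2 hyz' i hi i hi')
    · exact Or.inl (hπ.isNested_of_lt z.2 y.2 hyz'.symm hi' hj' hi hj (h' v hv) (h v hv) hii)
  have hcount : (Finset.univ.filter (IsMonotoneLabelling π)).card =
      (compatibleSeqs r π.parts.card Finset.univ).card := by
    refine Finset.card_bij (fun lam _ => lam.symm) ?_ ?_ ?_
    · intro lam hlam
      have hlam := (Finset.mem_filter.1 hlam).2
      refine mem_compatibleSeqs.2 ⟨by simp, lam.symm.injective,
        fun i j hij hn => ?_⟩
      have := hlam _ _ hn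
      simp only [Equiv.apply_symm_apply] at this
      exact this.not_gt hij
    · intro lam _ lam' _ h
      exact Equiv.symm_bijective.injective (DFunLike.coe_injective h)
    · intro V hV
      obtain ⟨-, hinj, hV⟩ := mem_compatibleSeqs.1 hV
      have hb : Function.Bijective V := by
        rw [Fintype.bijective_iff_injective_and_card]
        exact ⟨hinj, by simp⟩
      refine ⟨(Equiv.ofBijective V hb).symm, Finset.mem_filter.2 ⟨Finset.mem_univ _, ?_⟩, rfl⟩
      intro x y hxy
      by_contra hc
      obtain ⟨i, rfl⟩ := hb.surjective x
      obtain ⟨j, rfl⟩ := hb.surjective y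
      rw [Equiv.ofBijective_symm_apply_apply, Equiv.ofBijective_symm_apply_apply, not_lt] at hc
      rcases hc.lt_or_eq with hc | rfl
      · exact hV _ _ hc hxy
      · exact hirr _ hxy
  rw [hcount, ← card_compatibleSeqs_mul r hirr htr hforest _ Finset.univ (by simp)]
  congr 1
  rw [treeFactorial, ← Finset.prod_coe_sort]
  refine Finset.prod_congr rfl fun V _ => ?_
  rw [nestingNumber]
  symm
  -- Disjointness makes the weak bounds in `nestingNumber` strict for every block other than `V`, so
  -- they amount to nesting.
  refine Finset.card_bij (fun W _ => W.1) ?_ (fun _ _ _ _ h => Subtype.ext h) ?_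
  · intro W hW
    refine Finset.mem_filter.2 ⟨W.2, ?_⟩
    rcases (mem_hook.1 hW).2 with rfl | ⟨-, i, hi, j, hj, h⟩
    · exact fun w hw => ⟨w, hw, w, hw, le_rfl, le_rfl⟩
    · exact fun w hw => ⟨i, hi, j, hj, (h w hw).1.le, (h w hw).2.le⟩
  · intro W hW
    obtain ⟨hWm, hW⟩ := Finset.mem_filter.1 hW
    refine ⟨⟨W, hWm⟩, mem_hook.2 ⟨Finset.mem_univ _, ?_⟩, rfl⟩
    by_cases hWV : W = V.1
    · exact Or.inl (Subtype.ext hWV)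
    refine Or.inr ⟨hWV, V.1.min' (hne _ V.2), Finset.min'_mem _ _, V.1.max' (hne _ V.2),
      Finset.max'_mem _ _, fun w hw => ?_⟩
    obtain ⟨i, hi, j, hj, h1, h2⟩ := hW w hw
    exact ⟨lt_of_le_of_ne ((Finset.min'_le _ _ hi).trans h1)
        (hd _ V.2 _ hWm (Ne.symm hWV) _ (Finset.min'_mem _ _) _ hw),
      lt_of_le_of_ne (h2.trans (Finset.le_max' _ _ hj))
        (hd _ hWm _ V.2 hWV _ hw _ (Finset.max'_mem _ _))⟩

end Labellings

/-! ### From monotone partitions to the cumulant recursions. -/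

section Cumulants

variable {n : ℕ} {A : Type*}

theorem ofFn_restrict (a : Fin n → A) (V : Finset (Fin n)) :
    List.ofFn (restrict a V) = (subsetList V).map a := by
  have h : List.ofFn (V.orderEmbOfFin rfl) = subsetList V := by
    refine List.Pairwise.eq_of_mem_iff (r := (· < ·)) ?_
      ((List.pairwise_lt_finRange n).filter _) ?_
    · rw [List.pairwise_ofFn]
      exact fun i j hij => (V.orderEmbOfFin rfl).strictMono hij
    · intro x
      have := congrArg (x ∈ ·) (V.range_orderEmbOfFin rfl)
      simp only [Set.mem_range, Finset.mem_coe, eq_iff_iff] at this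
      simp [subsetList, List.mem_ofFn, this]
  rw [← h, List.map_ofFn]
  rfl

theorem fst_prod {ι : Type*} (s : Finset ι) (x : ι → Grassmann) :
    (∏ i ∈ s, x i).fst = ∏ i ∈ s, (x i).fst :=
  map_prod (TrivSqZeroExt.fstHom ℂ ℂ ℂ) x s

/-- The Leibniz rule; it turns the `ħ`-part of a block product into `∂`. -/
theorem snd_prod {ι : Type*} [DecidableEq ι] (s : Finset ι) (x : ι → Grassmann) :
    (∏ i ∈ s, x i).snd = ∑ i ∈ s, (x i).snd * ∏ j ∈ s.erase i, (x j).fst := by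
  induction s using Finset.induction_on with
  | empty => simp
  | insert i s hi ih =>
    rw [Finset.prod_insert hi, Finset.sum_insert hi, Finset.erase_insert hi,
      TrivSqZeroExt.snd_mul, ih, fst_prod, Finset.smul_sum]
    rw [add_comm]
    congr 1
    refine Finset.sum_congr rfl fun j hj => ?_
    rw [Finset.erase_insert_of_ne (ne_of_mem_of_not_mem hj hi).symm,
      Finset.prod_insert (fun h => hi (Finset.mem_of_mem_erase h)), smul_eq_mul, mul_left_comm]

theorem treeFactorial_ne_zero {π : SetPartition n} (hπ : π ∈ NC n) :
    (treeFactorial π : ℂ) ≠ 0 := by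
  classical
  have h := card_monotoneLabellings_mul π (Finset.mem_filter.1 hπ).2
  intro h0
  rw [Nat.cast_eq_zero.1 h0, mul_zero] at h
  exact Nat.factorial_ne_zero _ h.symm

/-- Each `π` is counted once per monotone labelling, that is `|π|!/τ(π)!` times. This reconciles the
two weights in the definitions of `h` and `h'`. -/
theorem sum_monotonePartitions (F : SetPartition n → ℂ) :
    ∑ p ∈ MonotonePartitions n, (1 / (p.1.parts.card.factorial : ℂ)) * F p.1 =
      ∑ π ∈ NC n, (1 / (treeFactorial π : ℂ)) * F π := by
  classical
  rw [MonotonePartitions, Finset.sum_sigma]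
  refine Finset.sum_congr rfl fun π hπ => ?_
  have h := card_monotoneLabellings_mul π (Finset.mem_filter.1 hπ).2
  have h0 : (π.parts.card.factorial : ℂ) ≠ 0 := by exact_mod_cast Nat.factorial_ne_zero _
  have h1 := treeFactorial_ne_zero hπ
  dsimp only
  rw [Finset.sum_const, nsmul_eq_mul, ← mul_assoc]
  congr 1
  rw [mul_one_div, div_eq_div_iff h0 h1, one_mul]
  exact_mod_cast h

theorem card_pos_of_mem {π : SetPartition n} {V : Finset (Fin n)} (hV : V ∈ π.parts) :
    1 ≤ V.card :=
  Finset.card_pos.2 (π.nonempty_of_mem_parts hV)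

/-- Families which satisfy the same triangular recursion over non-crossing partitions agree. -/
theorem eq_of_sum_blockProd_eq (f g : (m : ℕ) → (Fin m → A) → ℂ)
    (h : ∀ n, 1 ≤ n → ∀ a : Fin n → A,
      ∑ π ∈ NC n, (1 / (treeFactorial π : ℂ)) * blockProd f π a =
        ∑ π ∈ NC n, (1 / (treeFactorial π : ℂ)) * blockProd g π a)
    (n : ℕ) (hn : 1 ≤ n) (a : Fin n → A) : f n a = g n a := by
  induction n using Nat.strong_induction_on with
  | _ n ih =>
  obtain ⟨o, ho, hop, huniq⟩ := exists_unique_one hn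
  have hone : ∀ f : (m : ℕ) → (Fin m → A) → ℂ, blockProd f o a = f n a := fun f => by
    simp only [blockProd, hop, Finset.prod_singleton]
    exact family_card_eq f a _ (by simp) _
  -- Every other partition has only blocks smaller than `n`, where the families agree by induction,
  -- so the difference reduces to the one-block term.
  have h1 := sub_eq_zero.2 (h n hn a)
  rw [← Finset.sum_sub_distrib, Finset.sum_eq_single o _ (fun h => absurd ho h), hone, hone,
    ← mul_sub] at h1
  · exact sub_eq_zero.1 ((mul_eq_zero.1 h1).resolve_left
      (one_div_ne_zero (treeFactorial_ne_zero ho)))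
  · intro π _ hπ
    rw [sub_eq_zero]
    congr 1
    refine Finset.prod_congr rfl fun V hV => ?_
    exact ih _ (card_lt_of_mem (fun h => hπ (huniq π h)) hV) (card_pos_of_mem hV) _

/-- Families which satisfy the same linearised recursion over monotone partitions agree. -/
theorem eq_of_sum_blockDeriv_eq (h f g : (m : ℕ) → (Fin m → A) → ℂ)
    (heq : ∀ n, 1 ≤ n → ∀ a : Fin n → A,
      ∑ p ∈ MonotonePartitions n, (1 / (p.1.parts.card.factorial : ℂ)) * blockDeriv h f p.1 a =
        ∑ p ∈ MonotonePartitions n, (1 / (p.1.parts.card.factorial : ℂ)) * blockDeriv h g p.1 a)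
    (n : ℕ) (hn : 1 ≤ n) (a : Fin n → A) : f n a = g n a := by
  induction n using Nat.strong_induction_on with
  | _ n ih =>
  obtain ⟨o, ho, hop, huniq⟩ := exists_unique_one hn
  have hone : ∀ f : (m : ℕ) → (Fin m → A) → ℂ, blockDeriv h f o a = f n a := fun f => by
    simp only [blockDeriv, hop, Finset.sum_singleton, Finset.erase_singleton, Finset.prod_empty,
      mul_one]
    exact family_card_eq f a _ (by simp) _
  have h1 := heq n hn a
  rw [sum_monotonePartitions (fun π => blockDeriv h f π a),
    sum_monotonePartitions (fun π => blockDeriv h g π a), ← sub_eq_zero,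
    ← Finset.sum_sub_distrib, Finset.sum_eq_single o _ (fun h => absurd ho h), hone, hone,
    ← mul_sub] at h1
  · exact sub_eq_zero.1 ((mul_eq_zero.1 h1).resolve_left
      (one_div_ne_zero (treeFactorial_ne_zero ho)))
  · intro π _ hπ
    rw [sub_eq_zero]
    congr 1
    refine Finset.sum_congr rfl fun V hV => ?_
    rw [ih _ (card_lt_of_mem (fun h => hπ (huniq π h)) hV) (card_pos_of_mem hV)]

end Cumulants

end InfMonotone
end

/-! ### Comparing scalar and `ħ`-parts. -/

theorem mainTheorem4 {A : Type*} [Ring A] [Algebra ℂ A]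
    (φ φ' : A →ₗ[ℂ] ℂ) (hφ : φ 1 = 1) (hφ' : φ' 1 = 0)
    (ρ ρ' : InfMonotone.H A →ₗ[ℂ] ℂ)
    (hρ : InfMonotone.IsInfinitesimalCharacter (InfMonotone.tilde ρ ρ'))
    (hexp : ∀ x : InfMonotone.H A,
      InfMonotone.tilde (InfMonotone.Phi φ).toLinearMap (InfMonotone.PhiPrime φ φ') x =
        InfMonotone.starExp (InfMonotone.tilde ρ ρ') x)
    (n : ℕ) (hn : 1 ≤ n) (a : Fin n → A) :
    ρ' (InfMonotone.word (List.ofFn a)) = InfMonotone.infMonotoneCumulant φ φ' n a := by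
  open InfMonotone in
  set r : (m : ℕ) → (Fin m → A) → ℂ := fun m b => ρ (word (List.ofFn b)) with hr
  set r' : (m : ℕ) → (Fin m → A) → ℂ := fun m b => ρ' (word (List.ofFn b)) with hr'
  have hfst : ∀ (f f' : H A →ₗ[ℂ] ℂ) x, (tilde f f' x).fst = f x := fun f f' x => by simp [tilde]
  have hsnd : ∀ (f f' : H A →ₗ[ℂ] ℂ) x, (tilde f f' x).snd = f' x := fun f f' x => by simp [tilde]
  -- The two components of the exponential formula over `𝔾`.
  have key : ∀ m, 1 ≤ m → ∀ b : Fin m → A,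
      moment φ m b = ∑ p ∈ MonotonePartitions m, (1 / (p.1.parts.card.factorial : ℂ)) *
        blockProd r p.1 b ∧
      moment φ' m b = ∑ p ∈ MonotonePartitions m, (1 / (p.1.parts.card.factorial : ℂ)) *
        blockDeriv r r' p.1 b := by
    intro m hm b
    have h := hexp (word (List.ofFn b))
    rw [hρ.starExp_word] at h
    constructor
    · have h1 := congrArg TrivSqZeroExt.fst h
      rw [hfst, AlgHom.toLinearMap_apply, Phi, charExt_word _ _ _ hm, TrivSqZeroExt.fst_sum] at h1
      rw [moment, h1]
      refine Finset.sum_congr rfl fun p _ => ?_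
      rw [TrivSqZeroExt.fst_smul, fst_prod, smul_eq_mul]
      simp only [hfst, hr, blockProd, ofFn_restrict]
    · have h1 := congrArg TrivSqZeroExt.snd h
      rw [hsnd, PhiPrime_word _ _ _ _ hm, TrivSqZeroExt.snd_sum] at h1
      rw [moment, h1]
      refine Finset.sum_congr rfl fun p _ => ?_
      rw [TrivSqZeroExt.snd_smul, snd_prod, smul_eq_mul]
      simp only [hfst, hsnd, hr, hr', blockDeriv, ofFn_restrict]
  have h1 : ∀ m, 1 ≤ m → ∀ b : Fin m → A, r m b = monotoneCumulant φ m b :=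
    eq_of_sum_blockProd_eq _ _ fun m hm b => by
      rw [← moment_eq_sum_monotoneCumulant φ m hm b, (key m hm b).1,
        sum_monotonePartitions fun π => blockProd r π b]
  -- The undifferentiated factors of `∂ρ_π` may now be replaced by monotone cumulants, which gives
  -- the recursion of `h'`.
  refine eq_of_sum_blockDeriv_eq (monotoneCumulant φ) r' _ (fun m hm b => ?_) n hn a
  rw [← moment_eq_sum_infMonotoneCumulant φ φ' m hm b, (key m hm b).2]
  refine Finset.sum_congr rfl fun p _ => ?_
  congr 1
  refine Finset.sum_congr rfl fun V _ => ?_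
  congr 1
  refine Finset.prod_congr rfl fun W hW => ?_
  exact (h1 _ (card_pos_of_mem (Finset.mem_of_mem_erase hW)) _).symm
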